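/- **Proposition 2.4.** Let $n\ge 1$, let $s\in\left(0,\frac{n}{n+1}\right)$, and let $\omega$ be a smooth $n$-form on $\mathbb{R}^{n+1}$ with $\int_{\mathbb{S}^n}\omega\neq 0$; for example, $\omega$ may be any smooth extension to $\mathbb{R}^{n+1}$ of the (normalized or not normalized) volume form of $\mathbb{S}^n$, or $\omega=x^1\,dx^2\wedge\dots\wedge dx^{n+1}$. Then there exists a sequence of maps $f_k\in C^\infty(\mathbb{S}^n,\mathbb{R}^{n+1})$ such that $$\sup_{k\in\mathbb{N}}\Big(\|f_k\|_{L^\infty(\mathbb{S}^n)}+[f_k]_{W^{s,\frac ns}(\mathbb{S}^n)}\Big)<+\infty$$ but $$\int_{\mathbb{S}^n}f_k^*\omega\;\xrightarrow{k\to\infty}\;+\infty .$$ Here, for $p\ge 1$, $$[f]_{W^{s,p}(\mathbb{S}^n)}=\left(\int_{\mathbb{S}^n}\int_{\mathbb{S}^n}\frac{|f(x)-f(y)|^p}{|x-y|^{n+sp}}\,dx\,dy\right)^{1/p},$$ where $dx$, $dy$ denote the surface measure of $\mathbb{S}^n\subset\mathbb{R}^{n+1}$ and $|x-y|$ is the Euclidean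 distance. -/

import Mathlib

open scoped Manifold ContDiff ENNReal Topology

noncomputable section

/-- The Euclidean space `ℝ^m`. -/
abbrev Euc (m : ℕ) : Type := EuclideanSpace ℝ (Fin m)

/-- The round unit sphere `S^n ⊆ ℝ^{n+1}`, with Mathlib's manifold structure. -/
abbrev Sph (n : ℕ) : Type := Metric.sphere (0 : Euc (n + 1)) 1

/-- The surface measure of `S^n` (not normalized). -/
abbrev surfaceMeasure (n : ℕ) : MeasureTheory.Measure (Sph n) :=
  (MeasureTheory.volume : MeasureTheory.Measure (Euc (n + 1))).toSphere

/-- The Gagliardo seminorm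
`[f]_{W^{s,p}(S^n)} = (∫_{S^n} ∫_{S^n} |f(x) - f(y)|^p / |x - y|^{n + s p} dx dy)^{1/p}`,
as an extended nonnegative number; `|x - y|` is the Euclidean distance in `ℝ^{n+1}`. -/
def gagliardoSeminorm (n : ℕ) {m : ℕ} (s p : ℝ) (f : Sph n → Euc m) : ℝ≥0∞ :=
  (∫⁻ x, ∫⁻ y, ‖f x - f y‖ₑ ^ p / edist x y ^ ((n : ℝ) + s * p)
    ∂(surfaceMeasure n) ∂(surfaceMeasure n)) ^ (1 / p)

/-- The pullback `f^*η` of an `n`-form `η` on `ℝ^m` under `f : S^n → ℝ^m`, at the point `x`: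
`(f^*η)_x (v₁, …, v_n) = η_{f(x)} (df_x v₁, …, df_x v_n)` for `v_i ∈ T_x S^n`. -/
def pullbackForm {n m : ℕ} (f : Sph n → Euc m) (η : Euc m → Euc m [⋀^Fin n]→L[ℝ] ℝ) (x : Sph n) :
    TangentSpace (𝓡 n) x [⋀^Fin n]→L[ℝ] ℝ :=
  (η (f x)).compContinuousLinearMap (mvfderiv (𝓡 n) f x)

/-- The Riemannian volume form of `S^n`, oriented by the outer normal, at the point `x`:
`(v₁, …, v_n) ↦ det (x, v₁, …, v_n)`, where `v_i ∈ T_x S^n` is seen as a vector of `ℝ^{n+1}`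
through the differential of the inclusion. -/
def sphereVolumeForm (n : ℕ) (x : Sph n) : TangentSpace (𝓡 n) x [⋀^Fin n]→ₗ[ℝ] ℝ :=
  (((EuclideanSpace.basisFun (Fin (n + 1)) ℝ).toBasis.det).curryLeft (x : Euc (n + 1))).compLinearMap
    (mvfderiv (𝓡 n) (Subtype.val : Sph n → Euc (n + 1)) x).toLinearMap

/-- A basis of the tangent space `T_x S^n`: the coordinate vectors of the preferred chart at `x`. -/
def sphereFrame (n : ℕ) (x : Sph n) : Fin n → TangentSpace (𝓡 n) x :=
  fun i => (EuclideanSpace.single i (1 : ℝ) : Euc n)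

/-- The integral `∫_{S^n} α` of an `n`-form `α` over the oriented sphere. As `T_x S^n` has
dimension `n`, `α = ρ · vol_{S^n}` for a unique function `ρ`, which is the quotient of the values
of `α` and `vol_{S^n}` at any basis of the tangent space; and `∫_{S^n} α = ∫_{S^n} ρ dσ` for the
surface measure `σ`. -/
def integralForm {n : ℕ} (α : ∀ x : Sph n, TangentSpace (𝓡 n) x [⋀^Fin n]→L[ℝ] ℝ) : ℝ :=
  ∫ x, α x (sphereFrame n x) / sphereVolumeForm n x (sphereFrame n x) ∂(surfaceMeasure n)

/-- The volume form does not vanish on a basis, so that the quotient above is a genuine one. -/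
theorem sphereVolumeForm_frame_ne_zero (n : ℕ) (x : Sph n) :
    sphereVolumeForm n x (sphereFrame n x) ≠ 0 := by
  set L : Euc n →ₗ[ℝ] Euc (n + 1) :=
    (mvfderiv (𝓡 n) (Subtype.val : Sph n → Euc (n + 1)) x).toLinearMap with hL
  have hfact : Fact (Module.finrank ℝ (Euc (n + 1)) = n + 1) := ⟨by simp⟩
  have hinj : Function.Injective L := injective_mvfderiv_subtypeVal_sphere x
  have hrange : L.range = (ℝ ∙ (x : Euc (n + 1)))ᗮ := range_mvfderiv_subtypeVal x
  have hx : (x : Euc (n + 1)) ≠ 0 := ne_zero_of_mem_unit_sphere x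
  have hval : sphereVolumeForm n x (sphereFrame n x) =
      (EuclideanSpace.basisFun (Fin (n + 1)) ℝ).toBasis.det
        (Fin.cons (x : Euc (n + 1)) fun i => L (EuclideanSpace.single i (1 : ℝ))) := rfl
  have hli : LinearIndependent ℝ (Fin.cons (x : Euc (n + 1))
      fun i => L (EuclideanSpace.single i (1 : ℝ)) : Fin (n + 1) → Euc (n + 1)) := by
    rw [linearIndependent_finCons]
    constructor
    · have h1 := (EuclideanSpace.basisFun (Fin n) ℝ).toBasis.linearIndependent.map' L
        (LinearMap.ker_eq_bot.2 hinj)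
      have h2 : (L ∘ (EuclideanSpace.basisFun (Fin n) ℝ).toBasis) =
          fun i => L (EuclideanSpace.single i (1 : ℝ)) := by
        ext1 i
        simp
      rw [← h2]
      exact h1
    · intro hmem
      have hmem' : (x : Euc (n + 1)) ∈ L.range := by
        refine (Submodule.span_le.2 ?_) hmem
        rintro _ ⟨i, rfl⟩
        exact ⟨_, rfl⟩
      rw [hrange, Submodule.mem_orthogonal_singleton_iff_inner_right] at hmem'
      exact hx (inner_self_eq_zero.1 hmem')
  rw [hval]
  have hcard : Fintype.card (Fin (n + 1)) = Module.finrank ℝ (Euc (n + 1)) := by simp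
  have := ((EuclideanSpace.basisFun (Fin (n + 1)) ℝ).toBasis.isUnit_det
    (basisOfLinearIndependentOfCardEqFinrank hli hcard)).ne_zero
  rwa [coe_basisOfLinearIndependentOfCardEqFinrank] at this

/-- If `η` extends the volume form of `S^n`, then `∫_{S^n} η` is the area of `S^n`, so that it is
not zero. -/
theorem integralForm_ne_zero_of_extends_volumeForm (n : ℕ)
    (η : Euc (n + 1) → Euc (n + 1) [⋀^Fin n]→L[ℝ] ℝ)
    (hη : ∀ x : Sph n, (pullbackForm Subtype.val η x).toAlternatingMap = sphereVolumeForm n x) :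
    integralForm (pullbackForm (Subtype.val : Sph n → Euc (n + 1)) η) ≠ 0 := by
  have h : ∀ x : Sph n, pullbackForm Subtype.val η x (sphereFrame n x) /
      sphereVolumeForm n x (sphereFrame n x) = 1 := fun x => by
    have hx : pullbackForm Subtype.val η x (sphereFrame n x) =
        sphereVolumeForm n x (sphereFrame n x) := congrArg (fun a => a (sphereFrame n x)) (hη x)
    rw [hx]
    exact div_self (sphereVolumeForm_frame_ne_zero n x)
  unfold integralForm
  simp_rw [h]
  have h0 : surfaceMeasure n ≠ 0 := MeasureTheory.Measure.toSphere_ne_zero _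
  rw [MeasureTheory.integral_const, smul_eq_mul, mul_one]
  exact (MeasureTheory.measureReal_ne_zero_iff).2 (MeasureTheory.Measure.measure_univ_ne_zero.2 h0)

end

/-! By Stokes, a nonzero integral of η over the sphere forces dη(a) ≠ 0 at some point a
(`exists_extDeriv_ne_zero`). It then suffices to work with maps close to the constant a: take f = a
+ g, where g is supported in one chart of the sphere and has amplitude ε and frequency k. It is
built so that its roughly k^n cells enclose signed volumes of order ε^(n+1) that all add up with the
same sign.

Expand η to first order at a. The constant part integrates to zero; the linear part gives dη(a)
times the enclosed volume, of order ε^(n+1) k^n; the Taylor remainder is a small fraction of that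
same quantity once ε is small (`integral_pullback_oscMap_ge`). On the other side, f has oscillation
at most of order ε and Lipschitz constant at most of order εk. Splitting the Gagliardo integral at
distance 1/k bounds the p-th power of the seminorm, p = n/s, by a multiple of ε^p k^n
(`gagliardoSeminorm_le`). With ε = k^(-s) this bound does not depend on k, while the integral grows
like k^(n - s(n+1)), whose exponent is positive exactly because s < n/(n+1).

The chart is the central projection of an open hemisphere. The factor it produces in the density of
the pullback (`density_conicExt`) is its own Jacobian (`integral_gnomonic`), so integrals over the
sphere become flat integrals over ℝ^n. -/

noncomputable section

open MeasureTheory Function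

/-! ### Stokes' theorem in flat space for pullbacks under compactly supported maps. -/

section Stokes

variable {V E : Type*} [NormedAddCommGroup V] [NormedSpace ℝ V] [NormedAddCommGroup E]
  [NormedSpace ℝ E]

/-- The integral of a directional derivative of a compactly supported function vanishes. -/
theorem integral_fderiv_apply_eq_zero [FiniteDimensional ℝ V] [MeasurableSpace V] [BorelSpace V]
    (μ : Measure V) [μ.IsAddHaarMeasure] {h : V → ℝ} (hd : Differentiable ℝ h) (v : V)
    (hc : Continuous fun u => fderiv ℝ h u v) (hs : HasCompactSupport h) :
    ∫ u, fderiv ℝ h u v ∂μ = 0 := by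
  have hs' : HasCompactSupport fun u => fderiv ℝ h u v := hs.fderiv_apply (𝕜 := ℝ) v
  have := integral_mul_fderiv_eq_neg_fderiv_mul_of_integrable (μ := μ) (f := fun _ : V => (1 : ℝ))
    (g := h) (v := v) (by simp) (by simpa using hc.integrable_of_hasCompactSupport hs')
    (by simpa using hd.continuous.integrable_of_hasCompactSupport hs)
    (by intros; fun_prop) (by intros; exact hd _)
  simpa using this

/-- The partial derivatives of `φ` in the directions `e`. -/
def partials {ι : Type*} (e : ι → V) (φ : V → E) (u : V) : ι → E := fun i => fderiv ℝ φ u (e i)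

theorem continuous_partials {ι : Type*} (e : ι → V) {φ : V → E} (hφ : ContDiff ℝ 1 φ) :
    Continuous (partials e φ) :=
  continuous_pi fun _ => (hφ.continuous_fderiv one_ne_zero).clm_apply continuous_const

theorem sum_antisymm_eq_zero {n : ℕ} (a : Fin n → Fin n → ℝ) (h : ∀ k j, a k j = -a j k) :
    ∑ k, ∑ j, a k j = 0 := by
  have : ∑ k, ∑ j, a k j = -∑ k, ∑ j, a k j := by
    conv_lhs => rw [Finset.sum_comm]
    simp_rw [← Finset.sum_neg_distrib]
    exact Finset.sum_congr rfl fun k _ => Finset.sum_congr rfl fun j _ => h j k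
  linarith

/-- The divergence of the vector field whose `k`-th component is
`B(∂₁φ, …, φ, …, ∂ₙφ)` with `φ` in the `k`-th slot: second derivatives cancel. -/
theorem sum_fderiv_update_partials {n : ℕ} (e : Fin n → V) {B : V → E [⋀^Fin n]→L[ℝ] ℝ}
    (hB : ContDiff ℝ 1 B) {φ : V → E} (hφ : ContDiff ℝ 2 φ) (u : V) :
    ∑ k, fderiv ℝ (fun u => B u (update (partials e φ u) k (φ u))) u (e k) =
      ∑ k, fderiv ℝ B u (e k) (update (partials e φ u) k (φ u)) + n * B u (partials e φ u) := by
  have hφ1 : Differentiable ℝ φ := hφ.differentiable two_ne_zero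
  have hφ2 : Differentiable ℝ (fderiv ℝ φ) :=
    (hφ.fderiv_right (m := 1) (by norm_num)).differentiable one_ne_zero
  have hslot : ∀ k i, Differentiable ℝ fun u => update (partials e φ u) k (φ u) i := by
    intro k i
    by_cases hik : i = k
    · subst hik
      simpa using hφ1
    · simp only [update_of_ne hik, partials]
      fun_prop
  have hD : ∀ k i, fderiv ℝ (fun u => update (partials e φ u) k (φ u) i) u (e k) =
      if i = k then partials e φ u k else fderiv ℝ (fderiv ℝ φ) u (e k) (e i) := by
    intro k i
    split_ifs with hik
    · subst hik
      simp [partials]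
    · simp only [update_of_ne hik, partials]
      rw [fderiv_clm_apply hφ2.differentiableAt (by fun_prop)]
      simp
  have hsymm : ∀ v w, fderiv ℝ (fderiv ℝ φ) u v w = fderiv ℝ (fderiv ℝ φ) u w v := by
    intro v w
    exact (hφ.contDiffAt.isSymmSndFDerivAt (by simp)).eq v w
  -- These are the second-derivative terms of the divergence. Exchanging k and j swaps two slots of
  -- an alternating map and leaves the mixed derivative unchanged, so the array is antisymmetric.
  let a : Fin n → Fin n → ℝ := fun k j => if j = k then 0 else
    B u (update (update (partials e φ u) k (φ u)) j (fderiv ℝ (fderiv ℝ φ) u (e k) (e j)))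
  have ha : ∑ k, ∑ j, a k j = 0 := by
    refine sum_antisymm_eq_zero a fun k j => ?_
    by_cases hjk : j = k
    · simp [a, hjk]
    · simp only [a, if_neg hjk, if_neg (Ne.symm hjk)]
      rw [hsymm (e k) (e j), ← ContinuousAlternatingMap.coe_toAlternatingMap,
        ← (B u).toAlternatingMap.map_swap _ hjk]
      congr 1
      ext i
      by_cases h1 : i = j
      · subst h1; simp [Equiv.swap_apply_left]
      · by_cases h2 : i = k
        · subst h2; simp [update_of_ne h1, update_of_ne hjk]
        · simp [Equiv.swap_apply_of_ne_of_ne h1 h2, h1, h2]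
  have hk : ∀ k, fderiv ℝ (fun u => B u (update (partials e φ u) k (φ u))) u (e k) =
      fderiv ℝ B u (e k) (update (partials e φ u) k (φ u)) +
        (B u (partials e φ u) + ∑ j, a k j) := by
    intro k
    rw [fderiv_continuousAlternatingMap_apply_apply (hB.differentiable one_ne_zero u)
      (fun i => hslot k i u)]
    congr 1
    have : B u (partials e φ u) = ∑ j, if j = k then B u (partials e φ u) else 0 := by simp
    rw [this, ← Finset.sum_add_distrib]
    refine Finset.sum_congr rfl fun j _ => ?_
    rw [hD]
    by_cases hjk : j = k
    · subst hjk; simp [a]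
    · simp [a, hjk]
  simp_rw [hk, Finset.sum_add_distrib, ha]
  simp

theorem continuous_continuousAlternatingMap_apply {n : ℕ} {X : Type*} [TopologicalSpace X]
    {B : X → E [⋀^Fin n]→L[ℝ] ℝ} {v : X → Fin n → E} (hB : Continuous B) (hv : Continuous v) :
    Continuous fun x => B x (v x) := by
  have h : Differentiable ℝ fun p : (E [⋀^Fin n]→L[ℝ] ℝ) × (Fin n → E) => p.1 (p.2 ·) := fun p =>
    DifferentiableAt.continuousAlternatingMap_apply (by fun_prop) (by fun_prop)
  exact h.continuous.comp (hB.prodMk hv)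

/-- Stokes' theorem for compactly supported maps. -/
theorem integral_update_partials [FiniteDimensional ℝ V] [MeasurableSpace V] [BorelSpace V]
    (μ : Measure V) [μ.IsAddHaarMeasure] {n : ℕ} (e : Fin n → V) {B : V → E [⋀^Fin n]→L[ℝ] ℝ}
    (hB : ContDiff ℝ 1 B) {φ : V → E} (hφ : ContDiff ℝ 2 φ) (hs : HasCompactSupport φ) :
    ∫ u, ∑ k, fderiv ℝ B u (e k) (update (partials e φ u) k (φ u)) ∂μ +
      n * ∫ u, B u (partials e φ u) ∂μ = 0 := by
  -- A slot is needed below for `B u (partials e φ u)` to vanish where the derivative of φ does; for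
  -- n = 0 both terms are zero anyway.
  rcases Nat.eq_zero_or_pos n with rfl | hn
  · simp
  have hφ1 : ContDiff ℝ 1 φ := hφ.of_le (by norm_num)
  have hd : ∀ k i, Differentiable ℝ fun u => update (partials e φ u) k (φ u) i := by
    intro k i
    by_cases hik : i = k
    · subst hik
      simpa using hφ1.differentiable one_ne_zero
    · simp only [update_of_ne hik, partials]
      exact ((hφ.fderiv_right (m := 1) (by norm_num)).clm_apply contDiff_const).differentiable
        one_ne_zero
  have hdh : ∀ k, Differentiable ℝ fun u => B u (update (partials e φ u) k (φ u)) := fun k u =>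
    DifferentiableAt.continuousAlternatingMap_apply (hB.differentiable one_ne_zero u)
      fun i => hd k i u
  have hcu : ∀ k, Continuous fun u => update (partials e φ u) k (φ u) := fun k =>
    (continuous_partials e hφ1).update k hφ1.continuous
  have hck : ∀ k, Continuous fun u => fderiv ℝ B u (e k) (update (partials e φ u) k (φ u)) :=
    fun k => continuous_continuousAlternatingMap_apply
      ((hB.continuous_fderiv one_ne_zero).clm_apply continuous_const) (hcu k)
  have hcB : Continuous fun u => B u (partials e φ u) :=
    continuous_continuousAlternatingMap_apply hB.continuous (continuous_partials e hφ1)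
  have hzero : ∀ k u, φ u = 0 → ∀ α : E [⋀^Fin n]→L[ℝ] ℝ,
      α (update (partials e φ u) k (φ u)) = 0 := fun k u hu α =>
    α.map_coord_zero k (by simp [hu])
  have hint : ∀ k, Integrable (fun u => fderiv ℝ B u (e k) (update (partials e φ u) k (φ u))) μ :=
    fun k => (hck k).integrable_of_hasCompactSupport
      (hs.mono fun u hu h0 => hu (hzero k u h0 _))
  have hintB : Integrable (fun u => B u (partials e φ u)) μ := by
    refine hcB.integrable_of_hasCompactSupport ((hs.fderiv (𝕜 := ℝ)).mono fun u hu h0 => hu ?_)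
    exact (B u).map_coord_zero ⟨0, hn⟩ (by simp [partials, h0])
  have hcd : ∀ k, Continuous fun u =>
      fderiv ℝ (fun u => B u (update (partials e φ u) k (φ u))) u (e k) := by
    intro k
    have hslot : ∀ i, Continuous fun u =>
        fderiv ℝ (fun u => update (partials e φ u) k (φ u) i) u (e k) := by
      intro i
      by_cases hik : i = k
      · subst hik
        simpa using (hφ1.continuous_fderiv one_ne_zero).clm_apply continuous_const
      · simp only [update_of_ne hik, partials]
        exact (((hφ.fderiv_right (m := 1) (by norm_num)).clm_apply
          contDiff_const).continuous_fderiv one_ne_zero).clm_apply continuous_const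
    have : (fun u => fderiv ℝ (fun u => B u (update (partials e φ u) k (φ u))) u (e k)) = fun u =>
        fderiv ℝ B u (e k) (update (partials e φ u) k (φ u)) +
          ∑ i, B u (update (update (partials e φ u) k (φ u)) i
            (fderiv ℝ (fun u => update (partials e φ u) k (φ u) i) u (e k))) := by
      ext u
      exact fderiv_continuousAlternatingMap_apply_apply (hB.differentiable one_ne_zero u)
        (fun i => hd k i u) _
    rw [this]
    exact (hck k).add (continuous_finsetSum _ fun i _ =>
      continuous_continuousAlternatingMap_apply hB.continuous ((hcu k).update i (hslot i)))
  have hsum : ∫ u, ∑ k, fderiv ℝ (fun u => B u (update (partials e φ u) k (φ u))) u (e k) ∂μ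
      = 0 := by
    rw [integral_finsetSum]
    · refine Finset.sum_eq_zero fun k _ => integral_fderiv_apply_eq_zero μ (hdh k) _ (hcd k) ?_
      exact hs.mono fun u hu h0 => hu (hzero k u h0 _)
    · intro k _
      refine (hcd k).integrable_of_hasCompactSupport (HasCompactSupport.fderiv_apply (𝕜 := ℝ) ?_ _)
      exact hs.mono fun u hu h0 => hu (hzero k u h0 _)
  simp_rw [sum_fderiv_update_partials e hB hφ] at hsum
  rw [integral_add (integrable_finsetSum _ fun k _ => hint k) (hintB.const_mul _),
    integral_const_mul] at hsum
  exact hsum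

/-- The pullback of a constant `n`-form under a compactly supported map has integral zero. -/
theorem integral_const_form_partials_eq_zero [FiniteDimensional ℝ V] [MeasurableSpace V]
    [BorelSpace V] (μ : Measure V) [μ.IsAddHaarMeasure] {n : ℕ} (hn : n ≠ 0) (e : Fin n → V)
    (α : E [⋀^Fin n]→L[ℝ] ℝ) {φ : V → E} (hφ : ContDiff ℝ 2 φ) (hs : HasCompactSupport φ) :
    ∫ u, α (partials e φ u) ∂μ = 0 := by
  have h := integral_update_partials μ e (B := fun _ => α) contDiff_const hφ hs
  simpa [hn] using h

/-- In the term that feeds `v k` to `L`, the vector `x` stands first among the remaining ones.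
Moving it to slot k costs (-1)^k against the sign (-1)^(k+1) of the term, so each such term carries
a minus sign. The sum is the shape that appears in `integral_update_partials`. -/
theorem alternatizeUncurryFin_cons {n : ℕ} (L : E →L[ℝ] E [⋀^Fin n]→L[ℝ] ℝ) (x : E)
    (v : Fin n → E) :
    ContinuousAlternatingMap.alternatizeUncurryFin L (Fin.cons x v : Fin (n + 1) → E) =
      L x v - ∑ k, L (v k) (update v k x) := by
  rw [ContinuousAlternatingMap.alternatizeUncurryFin_apply, Fin.sum_univ_succ, sub_eq_add_neg,
    ← Finset.sum_neg_distrib]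
  congr 1
  · simp [Fin.removeNth_zero]
  refine Finset.sum_congr rfl fun k _ => ?_
  obtain ⟨m, rfl⟩ : ∃ m, n = m + 1 := ⟨n - 1, by have := k.pos; omega⟩
  have h1 : update v k x = k.insertNth x (k.removeNth v) := by simp
  have h2 : (k.succ.removeNth (Fin.cons x v : Fin (m + 1 + 1) → E) : Fin (m + 1) → E) =
      Matrix.vecCons x (k.removeNth v) := by
    ext i
    refine Fin.cases ?_ (fun i => ?_) i
    · simp [Fin.removeNth]
    · simp [Fin.removeNth]
  rw [h1, h2, ← ContinuousAlternatingMap.coe_toAlternatingMap,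
    ← ContinuousAlternatingMap.coe_toAlternatingMap, AlternatingMap.map_insertNth]
  simp [pow_succ]

/-- For a form with linear coefficients `L`, the pullback of `L` integrates to `1 / (n + 1)` times
the integral of `dL`. -/
theorem integral_linear_form_partials [FiniteDimensional ℝ V] [MeasurableSpace V]
    [BorelSpace V] (μ : Measure V) [μ.IsAddHaarMeasure] {n : ℕ} (e : Fin n → V)
    (L : E →L[ℝ] E [⋀^Fin n]→L[ℝ] ℝ) {φ : V → E} (hφ : ContDiff ℝ 2 φ)
    (hs : HasCompactSupport φ) :
    ∫ u, ContinuousAlternatingMap.alternatizeUncurryFin L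
      (Fin.cons (φ u) (partials e φ u) : Fin (n + 1) → E) ∂μ =
      (n + 1) * ∫ u, L (φ u) (partials e φ u) ∂μ := by
  have hφ1 : ContDiff ℝ 1 φ := hφ.of_le (by norm_num)
  have h := integral_update_partials μ e (B := fun u => L (φ u)) (L.contDiff.comp hφ1) hφ hs
  have hf : ∀ u v, fderiv ℝ (fun u => L (φ u)) u v = L (fderiv ℝ φ u v) := by
    intro u v
    have := (L.hasFDerivAt.comp u (hφ1.differentiable one_ne_zero u).hasFDerivAt).fderiv
    simp only [Function.comp_def] at this
    rw [this]; rfl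
  simp_rw [hf] at h
  simp_rw [alternatizeUncurryFin_cons]
  have hcL : Continuous fun u => L (φ u) (partials e φ u) :=
    continuous_continuousAlternatingMap_apply (L.continuous.comp hφ1.continuous)
      (continuous_partials e hφ1)
  have hck : ∀ k, Continuous fun u =>
      L (partials e φ u k) (update (partials e φ u) k (φ u)) := fun k =>
    continuous_continuousAlternatingMap_apply
      (L.continuous.comp ((continuous_apply k).comp (continuous_partials e hφ1)))
      ((continuous_partials e hφ1).update k hφ1.continuous)
  -- By Stokes (`h`) the subtracted sum integrates to -n times the integral of the first term, hence
  -- the factor n + 1.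
  rw [integral_sub]
  · have : ∀ u k, L (partials e φ u k) = L (fderiv ℝ φ u (e k)) := fun _ _ => rfl
    simp_rw [this]
    linarith
  · refine hcL.integrable_of_hasCompactSupport (hs.mono fun u hu h0 => hu ?_)
    simp [show φ u = 0 from h0]
  · refine integrable_finsetSum _ fun k _ => (hck k).integrable_of_hasCompactSupport
      (hs.mono fun u hu h0 => hu ?_)
    exact (L _).map_coord_zero k (by simp [show φ u = 0 from h0])

end Stokes

/-! ### Densities of pullbacks to the sphere, and the gnomonic chart. -/

section Density

/-- The standard basis of `ℝ^m`. -/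
def stdFrame (m : ℕ) : Fin m → Euc m := fun i => EuclideanSpace.single i 1

theorem topForm_apply {m : ℕ} (α : Euc m [⋀^Fin m]→L[ℝ] ℝ) (v : Fin m → Euc m) :
    α v = α (stdFrame m) * (EuclideanSpace.basisFun (Fin m) ℝ).toBasis.det v := by
  have h := AlternatingMap.eq_smul_basis_det (EuclideanSpace.basisFun (Fin m) ℝ).toBasis
    α.toAlternatingMap
  have h2 := congrArg (fun β => β v) h
  simp only [ContinuousAlternatingMap.coe_toAlternatingMap, AlternatingMap.smul_apply,
    smul_eq_mul] at h2
  rw [h2]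
  congr 2
  ext1 i
  simp [stdFrame]

/-- The wedge l ∧ γ has top degree, hence is a multiple of the determinant; the hypothesis kills
every term of its expansion except the first. This makes the quotient of a form by det(x, ·)
independent of the tangent frame. It is used with l = ⟨x, ·⟩, which vanishes on tangent vectors, and
with l = x₀ when γ vanishes in the radial direction. -/
theorem apply_mul_apply_eq_mul_det {n : ℕ} (l : Euc (n + 1) →L[ℝ] ℝ)
    (γ : Euc (n + 1) [⋀^Fin n]→L[ℝ] ℝ) (x : Euc (n + 1)) (w : Fin n → Euc (n + 1))
    (h : ∀ k, l (w k) * γ (update w k x) = 0) :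
    l x * γ w = ContinuousAlternatingMap.alternatizeUncurryFin (l.smulRight γ) (stdFrame (n + 1)) *
      (EuclideanSpace.basisFun (Fin (n + 1)) ℝ).toBasis.det (Fin.cons x w) := by
  rw [← topForm_apply, alternatizeUncurryFin_cons]
  simp [h]

/-- The image of `sphereFrame` in the ambient space. -/
def ambientFrame (n : ℕ) (x : Sph n) : Fin n → Euc (n + 1) := fun i =>
  mvfderiv (𝓡 n) (Subtype.val : Sph n → Euc (n + 1)) x (sphereFrame n x i)

theorem inner_ambientFrame (n : ℕ) (x : Sph n) (i : Fin n) :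
    inner ℝ (x : Euc (n + 1)) (ambientFrame n x i) = 0 := by
  have hfact : Fact (Module.finrank ℝ (Euc (n + 1)) = n + 1) := ⟨by simp⟩
  have h : ambientFrame n x i ∈ (ℝ ∙ (x : Euc (n + 1)))ᗮ := by
    rw [← range_mvfderiv_subtypeVal (n := n) x]
    exact ⟨_, rfl⟩
  exact Submodule.mem_orthogonal_singleton_iff_inner_right.1 h

theorem sphereVolumeForm_sphereFrame (n : ℕ) (x : Sph n) :
    sphereVolumeForm n x (sphereFrame n x) =
      (EuclideanSpace.basisFun (Fin (n + 1)) ℝ).toBasis.det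
        (Fin.cons (x : Euc (n + 1)) (ambientFrame n x)) := rfl

/-- For maps that extend to the ambient space, the chain rule replaces the manifold derivative by an
ordinary Fréchet derivative. -/
theorem pullbackForm_comp_val {n m : ℕ} (F : Euc (n + 1) → Euc m)
    (η : Euc m → Euc m [⋀^Fin n]→L[ℝ] ℝ) (x : Sph n)
    (hF : DifferentiableAt ℝ F (x : Euc (n + 1))) :
    pullbackForm (fun y : Sph n => F y) η x (sphereFrame n x) =
      η (F x) (fun i => fderiv ℝ F x (ambientFrame n x i)) := by
  have hfact : Fact (Module.finrank ℝ (Euc (n + 1)) = n + 1) := ⟨by simp⟩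
  have hval : MDifferentiableAt (𝓡 n) 𝓘(ℝ, Euc (n + 1)) (Subtype.val : Sph n → Euc (n + 1)) x :=
    (contMDiff_coe_sphere (m := 1) x).mdifferentiableAt one_ne_zero
  have h := mfderiv_comp x hF.mdifferentiableAt hval
  have key : ∀ v, mvfderiv (𝓡 n) (fun y : Sph n => F y) x v =
      fderiv ℝ F x (mvfderiv (𝓡 n) (Subtype.val : Sph n → Euc (n + 1)) x v) := by
    intro v
    have h' := congrArg (fun T => T v) h
    rw [mfderiv_eq_fderiv] at h'
    exact h'
  unfold pullbackForm
  rw [ContinuousAlternatingMap.compContinuousLinearMap_apply]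
  congr 1
  ext1 i
  exact key _

/-- The density of `η` on the sphere. -/
theorem density_val {n : ℕ} (η : Euc (n + 1) → Euc (n + 1) [⋀^Fin n]→L[ℝ] ℝ) (x : Sph n) :
    pullbackForm (Subtype.val : Sph n → Euc (n + 1)) η x (sphereFrame n x) /
      sphereVolumeForm n x (sphereFrame n x) =
    ContinuousAlternatingMap.alternatizeUncurryFin
      ((innerSL ℝ (x : Euc (n + 1))).smulRight (η x)) (stdFrame (n + 1)) := by
  rw [div_eq_iff (sphereVolumeForm_frame_ne_zero n x), sphereVolumeForm_sphereFrame,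
    ← apply_mul_apply_eq_mul_det]
  · have := pullbackForm_comp_val (fun y => y) η x (by fun_prop)
    simp only [fderiv_fun_id] at this
    rw [show pullbackForm (Subtype.val : Sph n → Euc (n + 1)) η x (sphereFrame n x) = _ from this]
    simp
  · intro k
    rw [innerSL_apply_apply, inner_ambientFrame, zero_mul]

/-- The projection of `ℝ^{n+1}` to the last `n` coordinates. -/
def tailProj (n : ℕ) : Euc (n + 1) →L[ℝ] Euc n :=
  LinearMap.toContinuousLinearMap
    { toFun := fun x => WithLp.toLp 2 fun i => x i.succ
      map_add' := fun _ _ => rfl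
      map_smul' := fun _ _ => rfl }

@[simp] theorem tailProj_apply (n : ℕ) (x : Euc (n + 1)) (i : Fin n) :
    tailProj n x i = x i.succ := rfl

/-- The first coordinate on `ℝ^{n+1}`. -/
def headProj (n : ℕ) : Euc (n + 1) →L[ℝ] ℝ := EuclideanSpace.proj (0 : Fin (n + 1))

@[simp] theorem headProj_apply (n : ℕ) (x : Euc (n + 1)) : headProj n x = x 0 := rfl

/-- The central projection to the hyperplane `x₀ = 1`. -/
def gnomonic (n : ℕ) (x : Euc (n + 1)) : Euc n := (x 0)⁻¹ • tailProj n x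

/-- The map on `ℝ^{n+1}`, homogeneous of degree zero, which is `a + g` in the gnomonic chart. -/
def conicExt {n : ℕ} (a : Euc (n + 1)) (g : Euc n → Euc (n + 1)) (x : Euc (n + 1)) :
    Euc (n + 1) :=
  a + if 0 < x 0 then g (gnomonic n x) else 0

theorem hasFDerivAt_gnomonic (n : ℕ) {x : Euc (n + 1)} (hx : x 0 ≠ 0) :
    HasFDerivAt (gnomonic n)
      ((x 0)⁻¹ • tailProj n + (-((x 0) ^ 2)⁻¹ • headProj n).smulRight (tailProj n x)) x := by
  have h1 : HasFDerivAt (fun y : Euc (n + 1) => (y 0)⁻¹) (-((x 0) ^ 2)⁻¹ • headProj n) x :=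
    (hasDerivAt_inv hx).comp_hasFDerivAt x (headProj n).hasFDerivAt
  exact h1.smul (tailProj n).hasFDerivAt

theorem contDiffAt_gnomonic (n : ℕ) {x : Euc (n + 1)} (hx : x 0 ≠ 0) :
    ContDiffAt ℝ ∞ (gnomonic n) x :=
  ((headProj n).contDiff.contDiffAt.inv hx).smul (tailProj n).contDiff.contDiffAt

theorem conicExt_eventuallyEq_of_pos {n : ℕ} (a : Euc (n + 1)) (g : Euc n → Euc (n + 1))
    {x : Euc (n + 1)} (hx : 0 < x 0) :
    conicExt a g =ᶠ[𝓝 x] fun y => a + g (gnomonic n y) := by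
  filter_upwards [(headProj n).continuous.continuousAt.eventually (lt_mem_nhds hx)] with y hy
  simp only [headProj_apply] at hy
  simp [conicExt, hy]

theorem eq_sum_head_tail_norm_sq (n : ℕ) (x : Euc (n + 1)) :
    ‖x‖ ^ 2 = x 0 ^ 2 + ‖tailProj n x‖ ^ 2 := by
  simp [EuclideanSpace.norm_sq_eq, Fin.sum_univ_succ]

/-- The delicate points are on the equator: there the tail is nonzero while x₀ = 0, so at nearby
points with x₀ > 0 the gnomonic image has norm at least R and g vanishes. Hence no singularity
arises where the chart ends. -/
theorem conicExt_eventuallyEq_of_nonpos {n : ℕ} (a : Euc (n + 1)) {g : Euc n → Euc (n + 1)}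
    {R : ℝ} (hg : ∀ u, R ≤ ‖u‖ → g u = 0) {x : Euc (n + 1)} (hx0 : x ≠ 0) (hx : x 0 ≤ 0) :
    conicExt a g =ᶠ[𝓝 x] fun _ => a := by
  rcases hx.lt_or_eq with hx | hx
  · filter_upwards [(headProj n).continuous.continuousAt.eventually (gt_mem_nhds hx)] with y hy
    simp only [headProj_apply] at hy
    simp [conicExt, hy.not_gt]
  have ht : 0 < ‖tailProj n x‖ := by
    have h := eq_sum_head_tail_norm_sq n x
    have h' : 0 < ‖x‖ := norm_pos_iff.2 hx0
    rw [hx] at h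
    by_contra hcon
    have : ‖tailProj n x‖ = 0 := le_antisymm (not_lt.1 hcon) (norm_nonneg _)
    rw [this] at h
    nlinarith
  have hcont : ContinuousAt (fun y : Euc (n + 1) => ‖tailProj n y‖ - R * y 0) x :=
    ((tailProj n).continuous.norm.sub (continuous_const.mul (headProj n).continuous)).continuousAt
  filter_upwards [hcont.eventually (lt_mem_nhds (a := 0) (by simpa [hx] using ht))] with y hy
  unfold conicExt
  split_ifs with hy0
  · rw [hg, add_zero]
    rw [gnomonic, norm_smul, Real.norm_of_nonneg (by positivity), inv_mul_eq_div, le_div_iff₀ hy0]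
    linarith
  · simp

theorem contDiffAt_conicExt {n : ℕ} (a : Euc (n + 1)) {g : Euc n → Euc (n + 1)}
    (hgs : ContDiff ℝ ∞ g) {R : ℝ} (hg : ∀ u, R ≤ ‖u‖ → g u = 0) {x : Euc (n + 1)}
    (hx0 : x ≠ 0) : ContDiffAt ℝ ∞ (conicExt a g) x := by
  rcases lt_or_ge 0 (x 0) with hx | hx
  · refine ContDiffAt.congr_of_eventuallyEq ?_ (conicExt_eventuallyEq_of_pos a g hx)
    exact contDiffAt_const.add (hgs.contDiffAt.comp x (contDiffAt_gnomonic n hx.ne'))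
  · exact contDiffAt_const.congr_of_eventuallyEq (conicExt_eventuallyEq_of_nonpos a hg hx0 hx)

theorem contMDiff_conicExt {n : ℕ} (a : Euc (n + 1)) {g : Euc n → Euc (n + 1)}
    (hgs : ContDiff ℝ ∞ g) {R : ℝ} (hg : ∀ u, R ≤ ‖u‖ → g u = 0) :
    ContMDiff (𝓡 n) 𝓘(ℝ, Euc (n + 1)) ∞ fun x : Sph n => conicExt a g x := by
  have hfact : Fact (Module.finrank ℝ (Euc (n + 1)) = n + 1) := ⟨by simp⟩
  intro x
  exact (contDiffAt_conicExt a hgs hg (ne_zero_of_mem_unit_sphere x)).contMDiffAt.comp x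
    (contMDiff_coe_sphere x)

/-- The density of the pullback in the gnomonic chart. -/
theorem density_conicExt {n : ℕ} (hn : n ≠ 0) (a : Euc (n + 1)) {g : Euc n → Euc (n + 1)}
    (hgs : ContDiff ℝ ∞ g) {R : ℝ} (hg : ∀ u, R ≤ ‖u‖ → g u = 0)
    (η : Euc (n + 1) → Euc (n + 1) [⋀^Fin n]→L[ℝ] ℝ) (x : Sph n) :
    pullbackForm (fun x : Sph n => conicExt a g x) η x (sphereFrame n x) /
      sphereVolumeForm n x (sphereFrame n x) =
    if 0 < (x : Euc (n + 1)) 0 then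
      ((x : Euc (n + 1)) 0 ^ (n + 1))⁻¹ * η (a + g (gnomonic n x))
        (partials (stdFrame n) g (gnomonic n x))
    else 0 := by
  have hx0 : (x : Euc (n + 1)) ≠ 0 := ne_zero_of_mem_unit_sphere x
  rw [pullbackForm_comp_val _ _ _
    ((contDiffAt_conicExt a hgs hg hx0).differentiableAt (by simp))]
  split_ifs with hx
  · set t : ℝ := (x : Euc (n + 1)) 0 with ht
    set u := gnomonic n x with hu
    have hfd : fderiv ℝ (conicExt a g) (x : Euc (n + 1)) = (fderiv ℝ g u).comp
        (t⁻¹ • tailProj n + (-(t ^ 2)⁻¹ • headProj n).smulRight (tailProj n x)) := by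
      rw [(conicExt_eventuallyEq_of_pos a g hx).fderiv_eq, fderiv_const_add]
      exact (((hgs.differentiable (by simp)) u).hasFDerivAt.comp (x : Euc (n + 1))
        (hasFDerivAt_gnomonic n hx.ne')).fderiv
    have hval : conicExt a g x = a + g u := by simp [conicExt, ← ht, hx, hu]
    -- Infinitesimal form of homogeneity of degree zero.
    have hradial : fderiv ℝ (conicExt a g) (x : Euc (n + 1)) x = 0 := by
      rw [hfd]
      have : (t⁻¹ • tailProj n + (-(t ^ 2)⁻¹ • headProj n).smulRight (tailProj n x))
          (x : Euc (n + 1)) = 0 := by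
        simp only [add_apply, smul_apply,
          ContinuousLinearMap.smulRight_apply, headProj_apply, ← ht, smul_eq_mul, ← add_smul]
        rw [show t⁻¹ + -(t ^ 2)⁻¹ * t = 0 by field_simp; ring, zero_smul]
      rw [ContinuousLinearMap.comp_apply, this, map_zero]
    have htan : ∀ i : Fin n, fderiv ℝ (conicExt a g) (x : Euc (n + 1)) (stdFrame (n + 1) i.succ) =
        t⁻¹ • partials (stdFrame n) g u i := by
      intro i
      rw [hfd]
      have : (t⁻¹ • tailProj n + (-(t ^ 2)⁻¹ • headProj n).smulRight (tailProj n x))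
          (stdFrame (n + 1) i.succ) = t⁻¹ • stdFrame n i := by
        ext j
        simp [stdFrame, Fin.succ_ne_zero]
      rw [ContinuousLinearMap.comp_apply, this, map_smul]
      rfl
    set γ := (η (conicExt a g x)).compContinuousLinearMap
      (fderiv ℝ (conicExt a g) (x : Euc (n + 1))) with hγ
    -- With l = x₀ the right side is evaluated on the standard basis, where the last n vectors have
    -- x₀ = 0 and derivatives t⁻¹ ∂ᵢg. This gives t^(-n), and l(x) = t supplies the last factor of
    -- t⁻¹.
    have hmain := apply_mul_apply_eq_mul_det (headProj n) γ x (ambientFrame n x) (by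
      intro k
      have : γ (update (ambientFrame n x) k x) = 0 := by
        rw [hγ, ContinuousAlternatingMap.compContinuousLinearMap_apply]
        exact ContinuousAlternatingMap.map_coord_zero _ k (by simp [hradial])
      rw [this, mul_zero])
    have hstd : stdFrame (n + 1) = Fin.cons (EuclideanSpace.single 0 1)
        fun i : Fin n => stdFrame (n + 1) i.succ := by
      ext1 i
      refine Fin.cases rfl (fun i => rfl) i
    have halt : ContinuousAlternatingMap.alternatizeUncurryFin ((headProj n).smulRight γ)
        (stdFrame (n + 1)) = (t⁻¹) ^ n * η (a + g u) (partials (stdFrame n) g u) := by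
      rw [hstd, alternatizeUncurryFin_cons]
      have h1 : ∀ k : Fin n, headProj n (stdFrame (n + 1) k.succ) = 0 := fun k => by
        simp [stdFrame]
      have h2 : γ (fun i : Fin n => stdFrame (n + 1) i.succ) =
          (t⁻¹) ^ n * η (a + g u) (partials (stdFrame n) g u) := by
        rw [hγ, ContinuousAlternatingMap.compContinuousLinearMap_apply, hval]
        have : (⇑(fderiv ℝ (conicExt a g) (x : Euc (n + 1))) ∘
            fun i : Fin n => stdFrame (n + 1) i.succ) =
            fun i => t⁻¹ • partials (stdFrame n) g u i := funext htan
        rw [this, ContinuousAlternatingMap.map_smul_univ (η (a + g u)) (fun _ => t⁻¹)]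
        simp
      simp [h1, h2]
    rw [div_eq_iff (sphereVolumeForm_frame_ne_zero n x), sphereVolumeForm_sphereFrame]
    rw [halt] at hmain
    simp only [headProj_apply, ← ht] at hmain
    have hγw : γ (ambientFrame n x) = η (conicExt a g x)
        (fun i => fderiv ℝ (conicExt a g) x (ambientFrame n x i)) := rfl
    rw [← hγw]
    refine mul_left_cancel₀ hx.ne' (hmain.trans ?_)
    rw [inv_pow]
    field_simp
    ring
  · have hfd : fderiv ℝ (conicExt a g) (x : Euc (n + 1)) = 0 := by
      rw [(conicExt_eventuallyEq_of_nonpos a hg hx0 (not_lt.1 hx)).fderiv_eq, fderiv_fun_const]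
      rfl
    have : η (conicExt a g x) (fun i => fderiv ℝ (conicExt a g) x (ambientFrame n x i)) = 0 :=
      ContinuousAlternatingMap.map_coord_zero _ ⟨0, Nat.pos_of_ne_zero hn⟩ (by simp [hfd])
    rw [this, zero_div]

end Density

/-! ### Polar coordinates, and the passage from the integral over the sphere to dη. -/

section Polar

theorem integral_volumeIoiPow (n : ℕ) (f : ℝ → ℝ) :
    ∫ r : Set.Ioi (0 : ℝ), f r ∂(Measure.volumeIoiPow n) = ∫ r in Set.Ioi (0 : ℝ), r ^ n * f r := by
  simp only [Measure.volumeIoiPow, ENNReal.ofReal]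
  rw [integral_withDensity_eq_integral_smul,
    integral_subtype_comap measurableSet_Ioi fun a ↦ Real.toNNReal (a ^ n) • f a]
  · refine setIntegral_congr_fun measurableSet_Ioi fun x hx => ?_
    simp only [NNReal.smul_def, Real.coe_toNNReal _ (pow_nonneg (le_of_lt hx) _), smul_eq_mul]
  · exact (measurable_subtype_coe.pow_const _).real_toNNReal

theorem integrable_polar (n : ℕ) {F : Euc (n + 1) → ℝ} (hF : Integrable F) :
    Integrable (fun p : Sph n × Set.Ioi (0 : ℝ) => F (p.2.1 • (p.1 : Euc (n + 1))))
      ((surfaceMeasure n).prod (Measure.volumeIoiPow n)) ∧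
    ∫ x, F x = ∫ p : Sph n × Set.Ioi (0 : ℝ), F (p.2.1 • (p.1 : Euc (n + 1)))
      ∂((surfaceMeasure n).prod (Measure.volumeIoiPow n)) := by
  have hmp := (volume : Measure (Euc (n + 1))).measurePreserving_homeomorphUnitSphereProd
  have hdim : Module.finrank ℝ (Euc (n + 1)) - 1 = n := by simp
  rw [hdim] at hmp
  have hemb : MeasurableEmbedding (homeomorphUnitSphereProd (Euc (n + 1))) :=
    Homeomorph.measurableEmbedding _
  have hcomp : (fun p : Sph n × Set.Ioi (0 : ℝ) => F (p.2.1 • (p.1 : Euc (n + 1)))) ∘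
      homeomorphUnitSphereProd (Euc (n + 1)) = fun x : ({0}ᶜ : Set (Euc (n + 1))) => F x := by
    ext x
    have hx : ‖(x : Euc (n + 1))‖ ≠ 0 := norm_ne_zero_iff.2 x.2
    simp [homeomorphUnitSphereProd, smul_smul, hx]
  constructor
  · rw [← hmp.integrable_comp_emb hemb, hcomp]
    have := (integrableOn_iff_comap_subtypeVal (μ := (volume : Measure (Euc (n + 1)))) (f := F)
      (measurableSet_singleton (0 : Euc (n + 1))).compl).1 hF.integrableOn
    exact this
  · rw [← hmp.integral_comp hemb]
    have h2 := integral_subtype_comap (μ := (volume : Measure (Euc (n + 1))))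
      (measurableSet_singleton (0 : Euc (n + 1))).compl F
    rw [restrict_compl_singleton] at h2
    rw [← h2]
    exact integral_congr_ae (Filter.Eventually.of_forall fun x => (congrFun hcomp x).symm)

/-- Polar coordinates, radial integration inside. -/
theorem integral_polar (n : ℕ) {F : Euc (n + 1) → ℝ} (hF : Integrable F) :
    ∫ x, F x = ∫ x : Sph n, (∫ r in Set.Ioi (0 : ℝ), r ^ n * F (r • (x : Euc (n + 1))))
      ∂(surfaceMeasure n) := by
  obtain ⟨h1, h2⟩ := integrable_polar n hF
  rw [h2, integral_prod _ h1]
  refine integral_congr_ae (Filter.Eventually.of_forall fun x => ?_)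
  exact integral_volumeIoiPow n fun r => F (r • (x : Euc (n + 1)))

/-- Polar coordinates, spherical integration inside. -/
theorem integral_polar_symm (n : ℕ) {F : Euc (n + 1) → ℝ} (hF : Integrable F) :
    ∫ x, F x = ∫ r in Set.Ioi (0 : ℝ), r ^ n * ∫ x : Sph n, F (r • (x : Euc (n + 1)))
      ∂(surfaceMeasure n) := by
  obtain ⟨h1, h2⟩ := integrable_polar n hF
  rw [h2, integral_prod_symm _ h1]
  exact integral_volumeIoiPow n fun r => ∫ x : Sph n, F (r • (x : Euc (n + 1))) ∂(surfaceMeasure n)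

/-- The surface measure is upper Ahlfors regular. -/
theorem surfaceMeasure_ball_le (n : ℕ) : ∃ C : ℝ, 0 < C ∧ ∀ (x : Sph n) (ρ : ℝ), 0 < ρ →
    surfaceMeasure n (Metric.ball x ρ) ≤ ENNReal.ofReal (C * ρ ^ n) := by
  set b : ℝ := (volume : Measure (Euc (n + 1))).real (Metric.ball 0 1) with hb
  have hbpos : 0 < b := by
    rw [hb, measureReal_def]
    exact ENNReal.toReal_pos (Metric.measure_ball_pos _ _ one_pos).ne' measure_ball_lt_top.ne
  refine ⟨2 ^ (n + 1) * b, by positivity, fun x ρ hρ => ?_⟩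
  have hmp := (volume : Measure (Euc (n + 1))).measurePreserving_homeomorphUnitSphereProd
  have hdim : Module.finrank ℝ (Euc (n + 1)) - 1 = n := by simp
  rw [hdim] at hmp
  -- Thicken the cap radially to 1 < r < 1 + ρ. As r ^ n ≥ 1 there, its volume is at least ρ times
  -- the area of the cap, and it lies in a Euclidean ball of radius 2ρ.
  set I : Set (Set.Ioi (0 : ℝ)) := Subtype.val ⁻¹' Set.Ioo 1 (1 + ρ) with hI
  have hImeas : MeasurableSet I := measurableSet_Ioo.preimage measurable_subtype_coe
  have hIvol : ENNReal.ofReal ρ ≤ Measure.volumeIoiPow n I := by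
    rw [Measure.volumeIoiPow, withDensity_apply _ hImeas]
    calc ENNReal.ofReal ρ = ∫⁻ _ in I, 1 ∂(Measure.comap Subtype.val volume) := by
          rw [setLIntegral_one, comap_subtype_coe_apply measurableSet_Ioi,
            Subtype.image_preimage_coe, Set.inter_eq_right.2, Real.volume_Ioo]
          · simp
          · exact fun r hr => lt_trans one_pos hr.1
      _ ≤ _ := by
          refine setLIntegral_mono' hImeas fun r hr => ?_
          rw [← ENNReal.ofReal_one]
          exact ENNReal.ofReal_le_ofReal (one_le_pow₀ hr.1.le)
  have hprod := hmp.measure_preimage (s := Metric.ball x ρ ×ˢ I)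
    (measurableSet_ball.prod hImeas).nullMeasurableSet
  rw [Measure.prod_prod, comap_subtype_coe_apply (measurableSet_singleton _).compl] at hprod
  have hsub : (Subtype.val '' (homeomorphUnitSphereProd (Euc (n + 1)) ⁻¹'
      (Metric.ball x ρ ×ˢ I))) ⊆ Metric.ball (x : Euc (n + 1)) (2 * ρ) := by
    rintro _ ⟨z, ⟨hz1, hz2⟩, rfl⟩
    have hz0 : ‖(z : Euc (n + 1))‖ ≠ 0 := norm_ne_zero_iff.2 z.2
    have hz1' : ‖(‖(z : Euc (n + 1))‖⁻¹ • (z : Euc (n + 1))) - x‖ < ρ := by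
      have h := Metric.mem_ball.1 hz1
      rw [Subtype.dist_eq, homeomorphUnitSphereProd_apply_fst_coe] at h
      rw [← dist_eq_norm]; exact h
    have hz2' : 1 < ‖(z : Euc (n + 1))‖ ∧ ‖(z : Euc (n + 1))‖ < 1 + ρ := by
      have h : ((homeomorphUnitSphereProd (Euc (n + 1)) z).2 : ℝ) ∈ Set.Ioo 1 (1 + ρ) := hz2
      rwa [homeomorphUnitSphereProd_apply_snd_coe] at h
    rw [mem_ball_iff_norm]
    have hdec : (z : Euc (n + 1)) - x = (1 - ‖(z : Euc (n + 1))‖⁻¹) • (z : Euc (n + 1)) +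
        ((‖(z : Euc (n + 1))‖⁻¹ • (z : Euc (n + 1))) - x) := by
      rw [sub_smul, one_smul]; abel
    have h1 : ‖(1 - ‖(z : Euc (n + 1))‖⁻¹) • (z : Euc (n + 1))‖ = ‖(z : Euc (n + 1))‖ - 1 := by
      rw [norm_smul, Real.norm_of_nonneg]
      · field_simp
      · rw [sub_nonneg]; exact inv_le_one_of_one_le₀ hz2'.1.le
    rw [hdec]
    calc _ ≤ _ := norm_add_le _ _
      _ < 2 * ρ := by rw [h1]; linarith [hz2'.2]
  have hle : surfaceMeasure n (Metric.ball x ρ) * ENNReal.ofReal ρ ≤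
      ENNReal.ofReal (2 ^ (n + 1) * b * ρ ^ n) * ENNReal.ofReal ρ := by
    calc _ ≤ surfaceMeasure n (Metric.ball x ρ) * Measure.volumeIoiPow n I := by gcongr
      _ ≤ volume (Metric.ball (x : Euc (n + 1)) (2 * ρ)) := by
          rw [← hprod]; exact measure_mono hsub
      _ = ENNReal.ofReal (2 ^ (n + 1) * b * ρ ^ n) * ENNReal.ofReal ρ := by
          rw [Measure.addHaar_ball_of_pos _ _ (by positivity), ← ENNReal.ofReal_mul (by positivity),
            hb, measureReal_def, ← ENNReal.ofReal_toReal (measure_ball_lt_top (x := (0 : Euc (n + 1)))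
              (μ := volume) (r := 1)).ne, ← ENNReal.ofReal_mul (by positivity),
            ENNReal.toReal_ofReal ENNReal.toReal_nonneg]
          congr 1
          simp only [finrank_euclideanSpace, Fintype.card_fin]
          ring
  exact (ENNReal.mul_le_mul_iff_left (by simpa using hρ) ENNReal.ofReal_ne_top).1 hle

/-- Integration in the gnomonic chart. -/
theorem integral_gnomonic (n : ℕ) {J : Euc n → ℝ} (hJ : Continuous J) (hJs : HasCompactSupport J) :
    ∫ x : Sph n, (if 0 < (x : Euc (n + 1)) 0 then
      ((x : Euc (n + 1)) 0 ^ (n + 1))⁻¹ * J (gnomonic n x) else 0) ∂(surfaceMeasure n) =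
      ∫ u, J u := by
  let e : ℝ × Euc n ≃ᵐ Euc (n + 1) :=
    (((MeasurableEquiv.refl ℝ).prodCongr (MeasurableEquiv.toLp 2 (Fin n → ℝ)).symm).trans
      (MeasurableEquiv.piFinSuccAbove (fun _ : Fin (n + 1) => ℝ) 0).symm).trans
      (MeasurableEquiv.toLp 2 (Fin (n + 1) → ℝ))
  have he : MeasurePreserving e :=
    (PiLp.volume_preserving_toLp (Fin (n + 1))).comp
      ((volume_preserving_piFinSuccAbove (fun _ : Fin (n + 1) => ℝ) 0).symm.comp
        ((MeasurePreserving.id (volume : Measure ℝ)).prod (PiLp.volume_preserving_ofLp (Fin n))))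
  have heemb : MeasurableEmbedding e := e.measurableEmbedding
  have he0 : ∀ p, e p 0 = p.1 := fun p => rfl
  have hes : ∀ p, tailProj n (e p) = p.2 := fun p => by
    ext i
    rfl
  -- The integral of F over the slab 0 < x₀ < 1 is computed twice. Slices x₀ = t give ∫₀¹ tⁿ dt
  -- times ∫ J; rays through x in the sphere leave the slab at r = 1/x₀ and give x₀^(-(n+1))/(n+1).
  let F : Euc (n + 1) → ℝ := fun x => if x 0 ∈ Set.Ioo (0 : ℝ) 1 then J (gnomonic n x) else 0
  have hFe : ∀ p : ℝ × Euc n, F (e p) = if p.1 ∈ Set.Ioo (0 : ℝ) 1 then J (p.1⁻¹ • p.2) else 0 := by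
    intro p
    simp only [F, gnomonic, he0, hes]
  have hF : Integrable F := by
    obtain ⟨C, hC⟩ := hJ.bounded_above_of_compact_support hJs
    obtain ⟨R, hR⟩ := hJs.isCompact.isBounded.exists_norm_le
    have hsupp : support F ⊆ Metric.closedBall 0 (1 + |R|) := by
      intro x hx
      have hx0 : x 0 ∈ Set.Ioo (0 : ℝ) 1 := by
        by_contra h
        exact hx (if_neg h)
      have hxJ : J (gnomonic n x) ≠ 0 := fun h => hx (by simp only [F, if_pos hx0, h])
      have h1 := (hR _ (subset_tsupport _ hxJ)).trans (le_abs_self R)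
      rw [gnomonic, norm_smul, norm_inv, Real.norm_of_nonneg hx0.1.le, inv_mul_eq_div,
        div_le_iff₀ hx0.1] at h1
      have h2 := eq_sum_head_tail_norm_sq n x
      have h3 : ‖tailProj n x‖ ≤ |R| :=
        h1.trans (mul_le_of_le_one_right (abs_nonneg _) hx0.2.le)
      rw [mem_closedBall_zero_iff]
      refine abs_le_of_sq_le_sq' ?_ (by positivity) |>.2
      have h4 : ‖tailProj n x‖ ^ 2 ≤ |R| ^ 2 := by gcongr
      have h5 : x 0 ^ 2 ≤ 1 := pow_le_one₀ hx0.1.le hx0.2.le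
      nlinarith [abs_nonneg R]
    have hmeas : Measurable F := by
      have h0 : Measurable fun x : Euc (n + 1) => x 0 := (headProj n).continuous.measurable
      refine Measurable.ite (measurableSet_Ioo.preimage h0) (hJ.measurable.comp ?_)
        measurable_const
      exact h0.inv.smul (tailProj n).continuous.measurable
    rw [← integrableOn_iff_integrable_of_support_subset hsupp]
    refine Measure.integrableOn_of_bounded (M := C) measure_closedBall_lt_top.ne
      hmeas.aestronglyMeasurable (Filter.Eventually.of_forall fun x => ?_)
    simp only [F]
    split_ifs
    · exact hC _
    · simpa using (norm_nonneg _).trans (hC 0)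
  have hFe_int : Integrable (fun p : ℝ × Euc n => F (e p)) := (he.integrable_comp_emb heemb).2 hF
  have hleft : ∫ x, F x = (n + 1 : ℝ)⁻¹ * ∫ u, J u := by
    rw [← he.integral_comp heemb, Measure.volume_eq_prod, integral_prod _ hFe_int]
    simp_rw [hFe]
    have : ∀ t : ℝ, ∫ v : Euc n, (if t ∈ Set.Ioo (0 : ℝ) 1 then J (t⁻¹ • v) else 0) =
        (Set.Ioo (0 : ℝ) 1).indicator (fun t => t ^ n * ∫ u, J u) t := by
      intro t
      by_cases ht : t ∈ Set.Ioo (0 : ℝ) 1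
      · simp only [ht, if_true, Set.indicator_of_mem]
        rw [Measure.integral_comp_inv_smul]
        simp [abs_of_pos ht.1]
      · simp [ht]
    simp_rw [this]
    rw [integral_indicator measurableSet_Ioo, integral_mul_const, ← integral_Ioc_eq_integral_Ioo,
      ← intervalIntegral.integral_of_le zero_le_one, integral_pow]
    simp
  have hright : ∫ x, F x = (n + 1 : ℝ)⁻¹ * ∫ x : Sph n, (if 0 < (x : Euc (n + 1)) 0 then
      ((x : Euc (n + 1)) 0 ^ (n + 1))⁻¹ * J (gnomonic n x) else 0) ∂(surfaceMeasure n) := by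
    rw [integral_polar n hF, ← integral_const_mul]
    refine integral_congr_ae (Filter.Eventually.of_forall fun x => ?_)
    set t : ℝ := (x : Euc (n + 1)) 0 with ht
    have hgn : ∀ r : ℝ, 0 < r → gnomonic n (r • (x : Euc (n + 1))) = gnomonic n x := by
      intro r hr
      simp only [gnomonic, map_smul, smul_smul, PiLp.smul_apply, smul_eq_mul, mul_inv]
      congr 1
      field_simp
    by_cases htp : 0 < t
    · simp only [← ht, htp, if_true]
      have : ∀ r ∈ Set.Ioi (0 : ℝ), r ^ n * F (r • (x : Euc (n + 1))) =
          (Set.Iio t⁻¹).indicator (fun r => r ^ n * J (gnomonic n x)) r := by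
        intro r hr
        simp only [F, hgn r hr, PiLp.smul_apply, smul_eq_mul, ← ht]
        have hiff : r * t ∈ Set.Ioo (0 : ℝ) 1 ↔ r ∈ Set.Iio t⁻¹ := by
          rw [Set.mem_Iio, ← one_div, lt_div_iff₀ htp]
          exact ⟨fun h => h.2, fun h => ⟨mul_pos hr htp, h⟩⟩
        by_cases h : r ∈ Set.Iio t⁻¹
        · rw [if_pos (hiff.2 h), Set.indicator_of_mem h]
        · rw [if_neg (fun h' => h (hiff.1 h')), Set.indicator_of_notMem h, mul_zero]
      rw [setIntegral_congr_fun measurableSet_Ioi this, setIntegral_indicator measurableSet_Iio,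
        Set.Ioi_inter_Iio, integral_mul_const, ← integral_Ioc_eq_integral_Ioo,
        ← intervalIntegral.integral_of_le (by positivity), integral_pow]
      simp
      ring
    · simp only [← ht, htp, if_false, mul_zero]
      refine setIntegral_eq_zero_of_forall_eq_zero fun r hr => ?_
      have : r * t ∉ Set.Ioo (0 : ℝ) 1 := fun h =>
        htp ((pos_iff_pos_of_mul_pos h.1).1 hr)
      simp only [F, PiLp.smul_apply, smul_eq_mul, ← ht, if_neg this, mul_zero]
  have := hleft.symm.trans hright
  exact (mul_left_cancel₀ (by positivity) this).symm

/-- Stokes' theorem for compactly supported `n`-forms on `ℝ^{n+1}`. -/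
theorem integral_extDeriv_eq_zero {n : ℕ} {ζ : Euc (n + 1) → Euc (n + 1) [⋀^Fin n]→L[ℝ] ℝ}
    (hζ : ContDiff ℝ 1 ζ) (hs : HasCompactSupport ζ) :
    ∫ y, extDeriv ζ y (stdFrame (n + 1)) = 0 := by
  have hdiff := hζ.differentiable one_ne_zero
  have happ : ∀ (w : Fin n → Euc (n + 1)) y v, fderiv ℝ (fun y => ζ y w) y v = fderiv ℝ ζ y v w := by
    intro w y v
    rw [fderiv_continuousAlternatingMap_apply_apply (hdiff y) (fun i => by fun_prop)]
    simp
  have hcont : ∀ (w : Fin n → Euc (n + 1)) v, Continuous fun y => fderiv ℝ ζ y v w := fun w v =>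
    continuous_continuousAlternatingMap_apply
      ((hζ.continuous_fderiv one_ne_zero).clm_apply continuous_const) continuous_const
  have hd : ∀ w : Fin n → Euc (n + 1), Differentiable ℝ fun y => ζ y w := fun w y =>
    DifferentiableAt.continuousAlternatingMap_apply (hdiff y) (fun i => by fun_prop)
  simp only [extDeriv, ContinuousAlternatingMap.alternatizeUncurryFin_apply, zsmul_eq_mul]
  rw [integral_finsetSum]
  · refine Finset.sum_eq_zero fun i _ => ?_
    rw [integral_const_mul]
    simp_rw [← happ]
    rw [integral_fderiv_apply_eq_zero _ (hd _) _ (by simp_rw [happ]; exact hcont _ _), mul_zero]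
    exact hs.mono fun y hy h0 => hy (by simp [show ζ y = 0 from h0])
  · intro i _
    refine Integrable.const_mul ((hcont _ _).integrable_of_hasCompactSupport ?_) _
    exact (hs.fderiv (𝕜 := ℝ)).mono fun y hy h0 => hy (by simp [show fderiv ℝ ζ y = 0 from h0])

/-- If the exterior derivative of `η` vanishes then so does the integral of `η` over the sphere. -/
theorem exists_extDeriv_ne_zero {n : ℕ} {η : Euc (n + 1) → Euc (n + 1) [⋀^Fin n]→L[ℝ] ℝ}
    (hη : ContDiff ℝ 1 η)
    (hvol : integralForm (pullbackForm (Subtype.val : Sph n → Euc (n + 1)) η) ≠ 0) :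
    ∃ a, extDeriv η a (stdFrame (n + 1)) ≠ 0 := by
  by_contra! hd
  let M : Euc (n + 1) → ℝ := fun y => ContinuousAlternatingMap.alternatizeUncurryFin
      ((innerSL ℝ y).smulRight (η y)) (stdFrame (n + 1))
  have hM : Continuous M := by
    simp only [M, ContinuousAlternatingMap.alternatizeUncurryFin_apply, zsmul_eq_mul]
    refine continuous_finsetSum _ fun i _ => continuous_const.mul ?_
    simp only [ContinuousLinearMap.smulRight_apply, innerSL_apply_apply,
      ContinuousAlternatingMap.smul_apply, smul_eq_mul]
    exact (by fun_prop : Continuous fun y : Euc (n + 1) => inner ℝ y (stdFrame (n + 1) i)).mul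
      (continuous_continuousAlternatingMap_apply hη.continuous continuous_const)
  let m : ℝ → ℝ := fun r => ∫ x : Sph n, M (r • (x : Euc (n + 1))) ∂(surfaceMeasure n)
  have hm : Continuous m := by
    have := continuousOn_integral_of_compact_support (μ := surfaceMeasure n)
      (f := fun (r : ℝ) (x : Sph n) => M (r • (x : Euc (n + 1)))) (s := Set.univ) isCompact_univ
      (by
        refine Continuous.continuousOn (hM.comp ?_)
        exact continuous_fst.smul (continuous_subtype_val.comp continuous_snd)) (by simp)
    exact continuousOn_univ.1 this
  have hm1 : m 1 ≠ 0 := by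
    convert hvol using 1
    unfold integralForm
    simp_rw [density_val]
    simp [m, M]
  let hat : ℝ → ℝ := fun t => max 0 (1 - 2 * |t - 1|)
  have hhat : Continuous hat := by fun_prop
  have hhat0 : ∀ t, 3 / 2 ≤ t → hat t = 0 := by
    intro t ht
    refine max_eq_left ?_
    have := le_abs_self (t - 1)
    linarith
  -- Test η against a radial cutoff Θ(|y|²) with Θ' = b. The weight m(√t) turns the final radial
  -- integrand into a nonnegative multiple of m(r)², so m need not be known to be constant in r.
  let b : ℝ → ℝ := fun t => hat t * m √t
  have hb : Continuous b := hhat.mul (hm.comp Real.continuous_sqrt)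
  -- The base point 2 lies beyond the support of `hat`, so Θ vanishes for large t and the cutoff has
  -- compact support.
  let Θ : ℝ → ℝ := fun t => ∫ τ in (2 : ℝ)..t, b τ
  have hΘ : ∀ t, HasDerivAt Θ (b t) t := fun t =>
    intervalIntegral.integral_hasDerivAt_right (hb.intervalIntegrable _ _)
      (hb.stronglyMeasurableAtFilter _ _) hb.continuousAt
  have hΘ0 : ∀ t, 3 / 2 ≤ t → Θ t = 0 := by
    intro t ht
    refine (intervalIntegral.integral_congr (g := fun _ => 0) fun τ hτ => ?_).trans (by simp)
    have h1 : 3 / 2 ≤ τ := le_trans (le_min (by norm_num) ht) hτ.1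
    simp [b, hhat0 τ h1]
  have hΘd : ContDiff ℝ 1 Θ := by
    rw [contDiff_one_iff_deriv]
    exact ⟨fun t => (hΘ t).differentiableAt, by rw [funext fun t => (hΘ t).deriv]; exact hb⟩
  have hχ : ContDiff ℝ 1 fun y : Euc (n + 1) => Θ (‖y‖ ^ 2) := hΘd.comp (contDiff_norm_sq ℝ)
  have hχd : ∀ y : Euc (n + 1), HasFDerivAt (fun y => Θ (‖y‖ ^ 2))
      (b (‖y‖ ^ 2) • (2 • innerSL ℝ y)) y := fun y =>
    (hΘ _).comp_hasFDerivAt y (hasStrictFDerivAt_norm_sq y).hasFDerivAt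
  have hbig : ∀ y : Euc (n + 1), y ∉ Metric.closedBall (0 : Euc (n + 1)) 2 →
      3 / 2 ≤ ‖y‖ ^ 2 := by
    intro y hy
    rw [mem_closedBall_zero_iff, not_le] at hy
    nlinarith
  -- Since dη = 0, only the wedge of the differential of the cutoff with η survives.
  have hext : ∀ y, extDeriv (fun y => Θ (‖y‖ ^ 2) • η y) y (stdFrame (n + 1)) =
      2 * (b (‖y‖ ^ 2) * M y) := by
    intro y
    have h1 : fderiv ℝ (fun y => Θ (‖y‖ ^ 2) • η y) y = _ :=
      ((hχd y).smul (hη.differentiable one_ne_zero y).hasFDerivAt).fderiv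
    have h2 : (b (‖y‖ ^ 2) • (2 • innerSL ℝ y)).smulRight (η y) =
        (2 * b (‖y‖ ^ 2)) • (innerSL ℝ y).smulRight (η y) := by
      ext v w
      simp
      ring
    rw [extDeriv, h1, h2, ContinuousAlternatingMap.alternatizeUncurryFin_add,
      ContinuousAlternatingMap.alternatizeUncurryFin_smul,
      ContinuousAlternatingMap.alternatizeUncurryFin_smul]
    have h3 := hd y
    simp only [extDeriv] at h3
    simp only [ContinuousAlternatingMap.add_apply, ContinuousAlternatingMap.smul_apply, h3, M,
      smul_eq_mul]
    ring
  have hzero : ∫ y : Euc (n + 1), 2 * (b (‖y‖ ^ 2) * M y) = 0 := by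
    simp_rw [← hext]
    refine integral_extDeriv_eq_zero (hχ.smul hη) ?_
    refine HasCompactSupport.intro (isCompact_closedBall (0 : Euc (n + 1)) 2) fun y hy => ?_
    simp [hΘ0 _ (hbig y hy)]
  have hint : Integrable fun y : Euc (n + 1) => 2 * (b (‖y‖ ^ 2) * M y) := by
    refine Continuous.integrable_of_hasCompactSupport
      (continuous_const.mul ((hb.comp (by fun_prop)).mul hM)) ?_
    refine HasCompactSupport.intro (isCompact_closedBall (0 : Euc (n + 1)) 2) fun y hy => ?_
    simp [b, hhat0 _ (hbig y hy)]
  rw [integral_polar_symm n hint] at hzero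
  let G : ℝ → ℝ := fun r => 2 * (r ^ n * hat (r ^ 2) * m r ^ 2)
  have hG : Continuous G := by
    have := hhat.comp (continuous_pow 2 : Continuous fun r : ℝ => r ^ 2)
    simp only [Function.comp_def] at this
    fun_prop
  have hGeq : ∀ r ∈ Set.Ioi (0 : ℝ), r ^ n * ∫ x : Sph n,
      2 * (b (‖r • (x : Euc (n + 1))‖ ^ 2) * M (r • (x : Euc (n + 1)))) ∂(surfaceMeasure n) =
      G r := by
    intro r hr
    have hnorm : ∀ x : Sph n, ‖r • (x : Euc (n + 1))‖ = r := fun x => by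
      simp [norm_smul, abs_of_pos (Set.mem_Ioi.1 hr)]
    simp_rw [hnorm]
    rw [integral_const_mul, integral_const_mul]
    simp only [b, G, Real.sqrt_sq (le_of_lt (Set.mem_Ioi.1 hr))]
    change _ * (2 * (_ * m r)) = _
    ring
  rw [setIntegral_congr_fun measurableSet_Ioi hGeq] at hzero
  have hGint : IntegrableOn G (Set.Ioi 0) := by
    refine Integrable.integrableOn (hG.integrable_of_hasCompactSupport ?_)
    refine HasCompactSupport.intro (isCompact_closedBall (0 : ℝ) 2) fun r hr => ?_
    have : 3 / 2 ≤ r ^ 2 := by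
      rw [mem_closedBall_zero_iff, not_le, Real.norm_eq_abs] at hr
      rw [← sq_abs]
      nlinarith
    simp [G, hhat0 _ this]
  have hGnn : 0 ≤ᵐ[volume.restrict (Set.Ioi 0)] G := by
    filter_upwards [ae_restrict_mem measurableSet_Ioi] with r hr
    have h1 : 0 ≤ r ^ n := pow_nonneg (le_of_lt (Set.mem_Ioi.1 hr)) n
    have h2 : 0 ≤ hat (r ^ 2) := le_max_left _ _
    simp only [Pi.zero_apply, G]
    positivity
  have hae := (setIntegral_eq_zero_iff_of_nonneg_ae hGnn hGint).1 hzero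
  have hG1 := Measure.eqOn_open_of_ae_eq hae isOpen_Ioi hG.continuousOn continuousOn_const
    (Set.mem_Ioi.2 one_pos)
  simp [G, hat, hm1] at hG1

end Polar

/-! ### The Gagliardo seminorm, by dyadic decomposition around the scale 1/k. -/

section Energy

theorem gagliardo_integrand_le {n m : ℕ} (p : ℝ) (hp : 0 ≤ p) (f : Sph n → Euc m) {x y : Sph n}
    {U L : ℝ} (hL : 0 < L) (hU : ‖f x - f y‖ ≤ U) (hd : L ≤ dist x y) :
    ‖f x - f y‖ₑ ^ p / edist x y ^ (2 * n) ≤ ENNReal.ofReal (U ^ p / L ^ (2 * n)) := by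
  have hU0 : 0 ≤ U := (norm_nonneg _).trans hU
  rw [ENNReal.ofReal_div_of_pos (by positivity), ← ENNReal.ofReal_rpow_of_nonneg hU0 hp,
    ENNReal.ofReal_pow hL.le]
  gcongr
  · rw [← ofReal_norm]
    exact ENNReal.ofReal_le_ofReal hU
  · rw [edist_dist]
    exact ENNReal.ofReal_le_ofReal hd

theorem setLIntegral_iUnion_le_of_geometric {X : Type*} [MeasurableSpace X] (μ : Measure X)
    (F : X → ℝ≥0∞) (A : ℕ → Set X) (hA : ∀ j, MeasurableSet (A j)) (c m : ℕ → ℝ) (K : ℝ)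
    (hK : 0 ≤ K) (hc : ∀ j, 0 ≤ c j) (hF : ∀ j, ∀ y ∈ A j, F y ≤ ENNReal.ofReal (c j))
    (hm : ∀ j, μ (A j) ≤ ENNReal.ofReal (m j)) (hcm : ∀ j, c j * m j ≤ K * (1 / 2) ^ j) :
    ∫⁻ y in ⋃ j, A j, F y ∂μ ≤ ENNReal.ofReal (2 * K) := by
  calc ∫⁻ y in ⋃ j, A j, F y ∂μ ≤ ∑' j, ∫⁻ y in A j, F y ∂μ := lintegral_iUnion_le _ _
    _ ≤ ∑' j, ENNReal.ofReal (K * (1 / 2) ^ j) := by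
        refine ENNReal.tsum_le_tsum fun j => ?_
        calc ∫⁻ y in A j, F y ∂μ ≤ ∫⁻ _ in A j, ENNReal.ofReal (c j) ∂μ :=
              setLIntegral_mono' (hA j) (hF j)
          _ = ENNReal.ofReal (c j) * μ (A j) := setLIntegral_const _ _
          _ ≤ ENNReal.ofReal (c j) * ENNReal.ofReal (m j) := by gcongr; exact hm j
          _ = ENNReal.ofReal (c j * m j) := (ENNReal.ofReal_mul (hc j)).symm
          _ ≤ _ := ENNReal.ofReal_le_ofReal (hcm j)
    _ = ENNReal.ofReal (2 * K) := by
        rw [← ENNReal.ofReal_tsum_of_nonneg (fun j => by positivity)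
          (summable_geometric_two.mul_left K), tsum_mul_left, tsum_geometric_two, mul_comm]

/-- Interpolation bound for the inner Gagliardo integral. -/
theorem lintegral_gagliardo_le {n : ℕ} (hn : n ≠ 0) {p : ℝ} (hp : (n : ℝ) + 1 ≤ p) :
    ∃ C : ℝ, 0 < C ∧ ∀ (m : ℕ) (f : Sph n → Euc m) (D k : ℝ), 0 ≤ D → 0 < k →
      (∀ x y, ‖f x - f y‖ ≤ D) → (∀ x y, ‖f x - f y‖ ≤ D * (k * dist x y)) → ∀ x,
      ∫⁻ y, ‖f x - f y‖ₑ ^ p / edist x y ^ (2 * n) ∂(surfaceMeasure n) ≤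
        ENNReal.ofReal (C * (D ^ p * k ^ n)) := by
  obtain ⟨C, hC, hball⟩ := surfaceMeasure_ball_le n
  refine ⟨4 * (8 ^ n * C), by positivity, fun m f D k hD hk hosc hlip x => ?_⟩
  have hp0 : 0 < p := lt_of_lt_of_le (by positivity) hp
  set F : Sph n → ℝ≥0∞ := fun y => ‖f x - f y‖ₑ ^ p / edist x y ^ (2 * n) with hF
  set K : ℝ := 8 ^ n * C * (D ^ p * k ^ n) with hK
  have hDp : 0 ≤ D ^ p := Real.rpow_nonneg hD p
  have hK0 : 0 ≤ K := by positivity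
  -- Dyadic shells around x: the Lipschitz bound is used where k · dist ≤ 1, the oscillation bound
  -- beyond.
  let near : ℕ → Set (Sph n) := fun j =>
    {y | (1 / 2) ^ (j + 1) < k * dist x y ∧ k * dist x y ≤ (1 / 2) ^ j}
  let far : ℕ → Set (Sph n) := fun j => {y | 2 ^ j ≤ k * dist x y ∧ k * dist x y < 2 ^ (j + 1)}
  have hmd : Measurable fun y : Sph n => k * dist x y := by fun_prop
  have hnear : ∫⁻ y in ⋃ j, near j, F y ∂(surfaceMeasure n) ≤ ENNReal.ofReal (2 * K) := by
    refine setLIntegral_iUnion_le_of_geometric _ F near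
      (fun j => (measurableSet_lt measurable_const hmd).inter (measurableSet_le hmd measurable_const))
      (fun j => (D * (1 / 2) ^ j) ^ p / ((1 / 2) ^ (j + 1) / k) ^ (2 * n))
      (fun j => C * (2 * (1 / 2) ^ j / k) ^ n) K hK0 (fun j => by positivity) ?_ ?_ ?_
    · intro j y hy
      refine gagliardo_integrand_le p hp0.le f (by positivity) ((hlip x y).trans ?_) ?_
      · gcongr
        exact hy.2
      · rw [div_le_iff₀ hk, mul_comm]
        exact hy.1.le
    · intro j
      refine (measure_mono fun y hy => ?_).trans (hball x _ (by positivity))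
      rw [Metric.mem_ball, dist_comm, lt_div_iff₀ hk, mul_comm]
      have : (0 : ℝ) < (1 / 2) ^ j := by positivity
      linarith [hy.2]
    · intro j
      set h : ℝ := (1 / 2) ^ j with hh
      have hh0 : 0 < h := by positivity
      have hh1 : h ≤ 1 := pow_le_one₀ (by norm_num) (by norm_num)
      -- A near shell contributes a multiple of h^p h^(-2n) h^n, and p ≥ n + 1 leaves at least one
      -- factor h. The 8 ^ n is 4 ^ n from the lower end of the shell times 2 ^ n from the enclosing
      -- ball.
      have hhp : h ^ p ≤ h ^ (n + 1) := by
        rw [← Real.rpow_natCast]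
        exact Real.rpow_le_rpow_of_exponent_ge hh0 hh1 (by exact_mod_cast hp)
      rw [Real.mul_rpow hD hh0.le, pow_succ, ← hh]
      calc D ^ p * h ^ p / (h * (1 / 2) / k) ^ (2 * n) * (C * (2 * h / k) ^ n)
          ≤ D ^ p * h ^ (n + 1) / (h * (1 / 2) / k) ^ (2 * n) * (C * (2 * h / k) ^ n) := by
            gcongr
        _ = K * h := by
            rw [hK, show (8 : ℝ) ^ n = 2 ^ n * (2 ^ n * 2 ^ n) by
              rw [← mul_pow, ← mul_pow]; norm_num]
            simp only [div_pow, mul_pow, two_mul n, pow_add, one_pow]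
            field_simp
  have hfar : ∫⁻ y in ⋃ j, far j, F y ∂(surfaceMeasure n) ≤ ENNReal.ofReal (2 * K) := by
    refine setLIntegral_iUnion_le_of_geometric _ F far
      (fun j => (measurableSet_le measurable_const hmd).inter (measurableSet_lt hmd measurable_const))
      (fun j => D ^ p / (2 ^ j / k) ^ (2 * n))
      (fun j => C * (2 ^ (j + 1) / k) ^ n) K hK0 (fun j => by positivity) ?_ ?_ ?_
    · intro j y hy
      refine gagliardo_integrand_le p hp0.le f (by positivity) (hosc x y) ?_
      rw [div_le_iff₀ hk, mul_comm]
      exact hy.1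
    · intro j
      refine (measure_mono fun y hy => ?_).trans (hball x _ (by positivity))
      rw [Metric.mem_ball, dist_comm, lt_div_iff₀ hk, mul_comm]
      exact hy.2
    · intro j
      have h1 : D ^ p / (2 ^ j / k) ^ (2 * n) * (C * (2 ^ (j + 1) / k) ^ n) =
          2 ^ n * C * (D ^ p * k ^ n) * ((1 / 2) ^ j) ^ n := by
        simp only [div_pow, mul_pow, two_mul n, pow_add, one_pow, pow_one]
        field_simp
      rw [h1, hK]
      have h2 : ((1 / 2 : ℝ) ^ j) ^ n ≤ (1 / 2) ^ j :=
        pow_le_of_le_one (by positivity) (pow_le_one₀ (by norm_num) (by norm_num)) hn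
      gcongr
      norm_num
  have hcover : (Set.univ : Set (Sph n)) ⊆ ({x} ∪ ⋃ j, near j) ∪ ⋃ j, far j := by
    intro y _
    by_cases hxy : y = x
    · exact Or.inl (Or.inl hxy)
    have hd : 0 < k * dist x y := mul_pos hk (dist_pos.2 (Ne.symm hxy))
    rcases le_total (k * dist x y) 1 with h1 | h1
    · obtain ⟨j, hj⟩ := exists_nat_pow_near_of_lt_one hd h1 (y := (1 / 2 : ℝ)) (by norm_num)
        (by norm_num)
      exact Or.inl (Or.inr (Set.mem_iUnion.2 ⟨j, hj⟩))
    · obtain ⟨j, hj⟩ := exists_nat_pow_near h1 (y := (2 : ℝ)) (by norm_num)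
      exact Or.inr (Set.mem_iUnion.2 ⟨j, hj⟩)
  -- On the diagonal the integrand is 0 / 0, which is 0 in `ℝ≥0∞`.
  have hx0 : ∫⁻ y in {x}, F y ∂(surfaceMeasure n) = 0 := by
    rw [lintegral_singleton]
    simp [hF, hp0]
  calc ∫⁻ y, F y ∂(surfaceMeasure n) = ∫⁻ y in Set.univ, F y ∂(surfaceMeasure n) := by simp
    _ ≤ ∫⁻ y in ({x} ∪ ⋃ j, near j) ∪ ⋃ j, far j, F y ∂(surfaceMeasure n) :=
        lintegral_mono_set hcover
    _ ≤ 0 + ENNReal.ofReal (2 * K) + ENNReal.ofReal (2 * K) := by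
        refine (lintegral_union_le _ _ _).trans (add_le_add ?_ hfar)
        exact (lintegral_union_le _ _ _).trans (add_le_add hx0.le hnear)
    _ = ENNReal.ofReal (4 * (8 ^ n * C) * (D ^ p * k ^ n)) := by
        rw [zero_add, ← ENNReal.ofReal_add (by positivity) (by positivity)]
        congr 1
        rw [hK]
        ring

/-- Interpolation between the oscillation and the Lipschitz constant, for the scale invariant
Gagliardo seminorm. -/
theorem gagliardoSeminorm_le {n : ℕ} (hn : n ≠ 0) {s p : ℝ} (hp : (n : ℝ) + 1 ≤ p)
    (hsp : s * p = n) :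
    ∃ C : ℝ≥0∞, C < ⊤ ∧ ∀ (m : ℕ) (f : Sph n → Euc m) (D k : ℝ), 0 ≤ D → 0 < k →
      (∀ x y, ‖f x - f y‖ ≤ D) → (∀ x y, ‖f x - f y‖ ≤ D * (k * dist x y)) →
      gagliardoSeminorm n s p f ≤ (ENNReal.ofReal (D ^ p * k ^ n) * C) ^ (1 / p) := by
  obtain ⟨C, hC, h⟩ := lintegral_gagliardo_le hn hp
  refine ⟨ENNReal.ofReal C * surfaceMeasure n Set.univ,
    ENNReal.mul_lt_top ENNReal.ofReal_lt_top (measure_lt_top _ _), fun m f D k hD hk ho hl => ?_⟩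
  have hp0 : 0 < p := lt_of_lt_of_le (by positivity) hp
  unfold gagliardoSeminorm
  refine ENNReal.rpow_le_rpow ?_ (by positivity)
  have hexp : (n : ℝ) + s * p = ((2 * n : ℕ) : ℝ) := by
    rw [hsp]; push_cast; ring
  simp_rw [hexp, ENNReal.rpow_natCast]
  calc _ ≤ ∫⁻ _, ENNReal.ofReal (C * (D ^ p * k ^ n)) ∂(surfaceMeasure n) :=
        lintegral_mono fun x => h m f D k hD hk ho hl x
    _ = _ := by
        rw [lintegral_const, ENNReal.ofReal_mul hC.le]
        ring

end Energy

/-! ### The oscillating map: its size, its Lipschitz constant and the volume it encloses. -/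

section Oscillation

theorem euc_norm_le_sum {m : ℕ} (v : Euc m) : ‖v‖ ≤ ∑ i, |v i| := by
  have h : v = ∑ i, v i • (EuclideanSpace.single i (1 : ℝ) : Euc m) := by
    ext j
    simp [Finset.sum_apply, Pi.single_apply]
  calc ‖v‖ = ‖∑ i, v i • (EuclideanSpace.single i (1 : ℝ) : Euc m)‖ := by rw [← h]
    _ ≤ ∑ i, ‖v i • (EuclideanSpace.single i (1 : ℝ) : Euc m)‖ := norm_sum_le _ _
    _ = ∑ i, |v i| := by simp [norm_smul]

theorem abs_apply_le_norm {m : ℕ} (v : Euc m) (i : Fin m) : |v i| ≤ ‖v‖ := by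
  simpa using PiLp.norm_apply_le v i

/-- A smooth cutoff, equal to one on the ball of radius `n + 1`. -/
def innerCutoff (n : ℕ) : ContDiffBump (0 : Euc n) :=
  ⟨n + 1, n + 2, by positivity, by linarith⟩

/-- A smooth cutoff, equal to one near the support of `innerCutoff`. -/
def outerCutoff (n : ℕ) : ContDiffBump (0 : Euc n) :=
  ⟨n + 3, n + 4, by positivity, by linarith⟩

/-- A compactly supported, rapidly oscillating map of amplitude `ε` and frequency `k`. -/
def oscMap (n : ℕ) (σ ε k : ℝ) (u : Euc n) : Euc (n + 1) :=
  ε • WithLp.toLp 2 (Fin.cons (σ * (innerCutoff n u * ∏ i, Real.cos (k * u i)))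
    fun i => outerCutoff n u * Real.sin (k * u i))

variable {n : ℕ} {σ ε k : ℝ}

theorem oscMap_zero (u : Euc n) : oscMap n σ ε k u 0 =
    ε * (σ * (innerCutoff n u * ∏ i, Real.cos (k * u i))) := rfl

theorem oscMap_succ (u : Euc n) (i : Fin n) : oscMap n σ ε k u i.succ =
    ε * (outerCutoff n u * Real.sin (k * u i)) := rfl

theorem contDiff_oscMap (n : ℕ) (σ ε k : ℝ) : ContDiff ℝ ∞ (oscMap n σ ε k) := by
  rw [contDiff_euclidean]
  have h1 : ContDiff ℝ ∞ fun u : Euc n => innerCutoff n u := (innerCutoff n).contDiff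
  have h2 : ContDiff ℝ ∞ fun u : Euc n => outerCutoff n u := (outerCutoff n).contDiff
  have h3 : ∀ i, ContDiff ℝ ∞ fun u : Euc n => k * u i := fun i =>
    contDiff_const.mul (EuclideanSpace.proj i : Euc n →L[ℝ] ℝ).contDiff
  intro i
  refine Fin.cases ?_ (fun i => ?_) i
  · simp only [oscMap_zero]
    exact contDiff_const.mul (contDiff_const.mul (h1.mul (contDiff_prod fun i _ =>
      Real.contDiff_cos.comp (h3 i))))
  · simp only [oscMap_succ]
    exact contDiff_const.mul (h2.mul (Real.contDiff_sin.comp (h3 i)))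

theorem oscMap_eq_zero {u : Euc n} (hu : (n : ℝ) + 4 ≤ ‖u‖) : oscMap n σ ε k u = 0 := by
  have h1 : innerCutoff n u = 0 := (innerCutoff n).zero_of_le_dist (by
    rw [dist_zero_right]; exact le_trans (by simp [innerCutoff]; linarith) hu)
  have h2 : outerCutoff n u = 0 := (outerCutoff n).zero_of_le_dist (by
    rw [dist_zero_right]; exact hu)
  ext i
  refine Fin.cases ?_ (fun i => ?_) i
  · simp [oscMap_zero, h1]
  · simp [oscMap_succ, h2]

theorem abs_cutoff_le_one (b : ContDiffBump (0 : Euc n)) (u : Euc n) : |b u| ≤ 1 := by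
  rw [abs_of_nonneg b.nonneg]; exact b.le_one

theorem abs_prod_cos_le_one (u : Euc n) : |∏ i, Real.cos (k * u i)| ≤ 1 := by
  rw [Finset.abs_prod]
  exact Finset.prod_le_one (fun _ _ => abs_nonneg _) fun _ _ => Real.abs_cos_le_one _

theorem norm_oscMap_le (hσ : |σ| = 1) (hε : 0 ≤ ε) (u : Euc n) :
    ‖oscMap n σ ε k u‖ ≤ (n + 1) * ε := by
  refine (euc_norm_le_sum _).trans ?_
  have h : ∀ i, |oscMap n σ ε k u i| ≤ ε := by
    intro i
    refine Fin.cases ?_ (fun i => ?_) i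
    · rw [oscMap_zero, abs_mul, abs_mul, abs_mul, hσ, one_mul, abs_of_nonneg hε]
      exact mul_le_of_le_one_right hε (mul_le_one₀ (abs_cutoff_le_one _ _) (abs_nonneg _)
        (abs_prod_cos_le_one u))
    · rw [oscMap_succ, abs_mul, abs_mul, abs_of_nonneg hε]
      exact mul_le_of_le_one_right hε (mul_le_one₀ (abs_cutoff_le_one _ _) (abs_nonneg _)
        (Real.abs_sin_le_one _))
  calc _ ≤ ∑ _i : Fin (n + 1), ε := Finset.sum_le_sum fun i _ => h i
    _ = _ := by simp

theorem abs_prod_sub_prod_le {ι : Type*} (s : Finset ι) (a b : ι → ℝ) (ha : ∀ i, |a i| ≤ 1)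
    (hb : ∀ i, |b i| ≤ 1) : |∏ i ∈ s, a i - ∏ i ∈ s, b i| ≤ ∑ i ∈ s, |a i - b i| := by
  classical
  induction s using Finset.induction_on with
  | empty => simp
  | insert i s hi ih =>
    rw [Finset.prod_insert hi, Finset.prod_insert hi, Finset.sum_insert hi]
    have h1 : |∏ j ∈ s, a j| ≤ 1 := by
      rw [Finset.abs_prod]
      exact Finset.prod_le_one (fun _ _ => abs_nonneg _) fun j _ => ha j
    calc _ = |(a i - b i) * ∏ j ∈ s, a j + b i * (∏ j ∈ s, a j - ∏ j ∈ s, b j)| := by ring_nf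
      _ ≤ |a i - b i| * |∏ j ∈ s, a j| + |b i| * |∏ j ∈ s, a j - ∏ j ∈ s, b j| := by
        rw [← abs_mul, ← abs_mul]; exact abs_add_le _ _
      _ ≤ |a i - b i| * 1 + 1 * ∑ j ∈ s, |a j - b j| := by
        gcongr
        exact hb i
      _ = _ := by ring

theorem abs_mul_sub_mul_le {a b c d : ℝ} (hb : |b| ≤ 1) (hc : |c| ≤ 1) :
    |a * b - c * d| ≤ |a - c| + |b - d| := by
  calc |a * b - c * d| = |(a - c) * b + c * (b - d)| := by ring_nf
    _ ≤ |a - c| * |b| + |c| * |b - d| := by rw [← abs_mul, ← abs_mul]; exact abs_add_le _ _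
    _ ≤ |a - c| * 1 + 1 * |b - d| := by gcongr
    _ = _ := by ring

theorem exists_cutoff_lipschitz (b : ContDiffBump (0 : Euc n)) :
    ∃ L : ℝ, 0 ≤ L ∧ ∀ u v, |b u - b v| ≤ L * ‖u - v‖ := by
  obtain ⟨L, hL⟩ := (b.contDiff (n := 1)).lipschitzWith_of_hasCompactSupport b.hasCompactSupport
    one_ne_zero
  exact ⟨L, L.2, fun u v => by simpa [Real.dist_eq, dist_eq_norm] using hL.dist_le_mul u v⟩

/-- The trigonometric factors cost k; the cutoffs cost fixed constants, absorbed because k ≥ 1. What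
matters is that A does not depend on ε or k. -/
theorem oscMap_lipschitz (n : ℕ) : ∃ A : ℝ, 0 ≤ A ∧ ∀ σ ε k : ℝ, |σ| = 1 → 0 ≤ ε → 1 ≤ k →
    ∀ u v, ‖oscMap n σ ε k u - oscMap n σ ε k v‖ ≤ A * (ε * k) * ‖u - v‖ := by
  obtain ⟨L₁, hL₁, h1⟩ := exists_cutoff_lipschitz (innerCutoff n)
  obtain ⟨L₂, hL₂, h2⟩ := exists_cutoff_lipschitz (outerCutoff n)
  refine ⟨(n + 1) * (L₁ + L₂ + n + 1), by positivity, fun σ ε k hσ hε hk u v => ?_⟩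
  have hk0 : 0 ≤ k := zero_le_one.trans hk
  have hcoord : ∀ i, |k * u i - k * v i| ≤ k * ‖u - v‖ := by
    intro i
    rw [← mul_sub, abs_mul, abs_of_nonneg hk0]
    gcongr
    exact abs_apply_le_norm (u - v) i
  have hd : 0 ≤ ‖u - v‖ := norm_nonneg _
  have hkd : ‖u - v‖ ≤ k * ‖u - v‖ := le_mul_of_one_le_left hd hk
  have hcos : |∏ i, Real.cos (k * u i) - ∏ i, Real.cos (k * v i)| ≤ n * (k * ‖u - v‖) := by
    refine (abs_prod_sub_prod_le _ _ _ (fun _ => Real.abs_cos_le_one _)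
      fun _ => Real.abs_cos_le_one _).trans ?_
    calc _ ≤ ∑ _i : Fin n, k * ‖u - v‖ := Finset.sum_le_sum fun i _ =>
          (Real.abs_cos_sub_cos_le _ _).trans (hcoord i)
      _ = _ := by simp
  have h : ∀ i, |(oscMap n σ ε k u - oscMap n σ ε k v) i| ≤
      ε * ((L₁ + L₂ + n + 1) * (k * ‖u - v‖)) := by
    intro i
    rw [PiLp.sub_apply]
    refine Fin.cases ?_ (fun i => ?_) i
    · rw [oscMap_zero, oscMap_zero, ← mul_sub, ← mul_sub, abs_mul, abs_mul, hσ, one_mul,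
        abs_of_nonneg hε]
      gcongr
      refine (abs_mul_sub_mul_le (abs_prod_cos_le_one u) (abs_cutoff_le_one _ v)).trans ?_
      have := (h1 u v).trans (mul_le_mul_of_nonneg_left hkd hL₁)
      have h3 : 0 ≤ L₂ * (k * ‖u - v‖) := by positivity
      nlinarith
    · rw [oscMap_succ, oscMap_succ, ← mul_sub, abs_mul, abs_of_nonneg hε]
      gcongr
      refine (abs_mul_sub_mul_le (Real.abs_sin_le_one _) (abs_cutoff_le_one _ v)).trans ?_
      have := (h2 u v).trans (mul_le_mul_of_nonneg_left hkd hL₂)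
      have h3 : 0 ≤ L₁ * (k * ‖u - v‖) := by positivity
      have h4 : 0 ≤ n * (k * ‖u - v‖) := by positivity
      have h5 := (Real.abs_sin_sub_sin_le (k * u i) (k * v i)).trans (hcoord i)
      nlinarith
  refine (euc_norm_le_sum _).trans ((Finset.sum_le_sum fun i _ => h i).trans (le_of_eq ?_))
  simp
  ring

/-- The determinant, as a continuous alternating map. -/
def detForm (m : ℕ) : Euc m [⋀^Fin m]→L[ℝ] ℝ :=
  { (EuclideanSpace.basisFun (Fin m) ℝ).toBasis.det with
    cont := by
      change Continuous fun v : Fin m → Euc m =>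
        (EuclideanSpace.basisFun (Fin m) ℝ).toBasis.det v
      simp only [Module.Basis.det_apply]
      refine Continuous.matrix_det (continuous_matrix fun i j => ?_)
      simp only [Module.Basis.toMatrix_apply, OrthonormalBasis.coe_toBasis_repr_apply,
        EuclideanSpace.basisFun_repr]
      exact (EuclideanSpace.proj i : Euc m →L[ℝ] ℝ).continuous.comp (continuous_apply j) }

theorem detForm_apply {m : ℕ} (v : Fin m → Euc m) :
    detForm m v = Matrix.det (Matrix.of fun i j => v j i) := by
  change (EuclideanSpace.basisFun (Fin m) ℝ).toBasis.det v = _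
  rw [Module.Basis.det_apply]
  rfl

/-- The form `x⁰ dx¹ ∧ ⋯ ∧ dxⁿ`. -/
def headForm (n : ℕ) : Euc (n + 1) →L[ℝ] Euc (n + 1) [⋀^Fin n]→L[ℝ] ℝ :=
  (headProj n).smulRight ((detForm n).compContinuousLinearMap (tailProj n))

theorem headForm_apply (x : Euc (n + 1)) (v : Fin n → Euc (n + 1)) :
    headForm n x v = x 0 * detForm n fun i => tailProj n (v i) := rfl

/-- `headForm` is the reference form whose differential is the volume form; it measures the enclosed
volume. -/
theorem extDeriv_headForm (n : ℕ) :
    ContinuousAlternatingMap.alternatizeUncurryFin (headForm n) (stdFrame (n + 1)) = 1 := by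
  have hstd : stdFrame (n + 1) = Fin.cons (EuclideanSpace.single 0 1)
      fun i : Fin n => stdFrame (n + 1) i.succ := by
    ext1 i
    refine Fin.cases rfl (fun i => rfl) i
  rw [hstd, alternatizeUncurryFin_cons]
  have h1 : ∀ k : Fin n, stdFrame (n + 1) k.succ 0 = 0 := fun k => by simp [stdFrame]
  have h2 : ∀ k : Fin n, tailProj n (stdFrame (n + 1) k.succ) = stdFrame n k := fun k => by
    ext j
    simp [stdFrame]
  have h3 : detForm n (stdFrame n) = 1 := by
    rw [detForm_apply]
    convert Matrix.det_one (n := Fin n) (R := ℝ)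
    ext i j
    simp [stdFrame, Matrix.one_apply]
  simp only [headForm_apply, h1, h2, h3, zero_mul, Finset.sum_const_zero, sub_zero]
  simp

/-- Where the inner cutoff is nonzero the outer one is locally 1, so the Jacobian matrix of the last
n coordinates is diagonal with entries εk cos(k uᵢ). Its determinant repeats the product of cosines
in the first coordinate, so squares appear and nothing cancels. -/
theorem headForm_oscMap (σ ε k : ℝ) (u : Euc n) :
    headForm n (oscMap n σ ε k u) (partials (stdFrame n) (oscMap n σ ε k) u) =
      σ * (ε ^ (n + 1) * k ^ n) * (innerCutoff n u * ∏ i, Real.cos (k * u i) ^ 2) := by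
  rw [headForm_apply, oscMap_zero]
  by_cases hu : innerCutoff n u = 0
  · simp [hu]
  have hu1 : ‖u‖ < n + 2 := by
    by_contra h
    exact hu ((innerCutoff n).zero_of_le_dist (by
      rw [dist_zero_right]; simpa [innerCutoff] using not_lt.1 h))
  have hdiff : Differentiable ℝ (oscMap n σ ε k) :=
    (contDiff_oscMap n σ ε k).differentiable (by simp)
  have hpart : ∀ i j : Fin n, tailProj n (partials (stdFrame n) (oscMap n σ ε k) u j) i =
      if i = j then ε * (k * Real.cos (k * u i)) else 0 := by
    intro i j
    have h1 : HasFDerivAt (fun w => oscMap n σ ε k w i.succ)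
        ((EuclideanSpace.proj i.succ : Euc (n + 1) →L[ℝ] ℝ).comp
          (fderiv ℝ (oscMap n σ ε k) u)) u :=
      (EuclideanSpace.proj i.succ : Euc (n + 1) →L[ℝ] ℝ).hasFDerivAt.comp u (hdiff u).hasFDerivAt
    have hev : (fun w => oscMap n σ ε k w i.succ) =ᶠ[𝓝 u]
        fun w => ε * Real.sin (k * w i) := by
      filter_upwards [continuous_norm.continuousAt.eventually (gt_mem_nhds hu1)] with w hw
      have : outerCutoff n w = 1 := (outerCutoff n).one_of_mem_closedBall (by
        rw [mem_closedBall_zero_iff]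
        have : (outerCutoff n).rIn = n + 3 := rfl
        linarith)
      rw [oscMap_succ, this, one_mul]
    have h2 : HasFDerivAt (fun w : Euc n => ε * Real.sin (k * w i))
        (ε • (Real.cos (k * u i) • (k • (EuclideanSpace.proj i : Euc n →L[ℝ] ℝ)))) u :=
      (((EuclideanSpace.proj i : Euc n →L[ℝ] ℝ).hasFDerivAt.const_mul k).sin).const_mul ε
    have h3 := (h1.congr_of_eventuallyEq hev.symm).unique h2
    have h4 := congrArg (fun T => T (stdFrame n j)) h3
    simp only [ContinuousLinearMap.comp_apply, smul_apply,
      smul_eq_mul] at h4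
    rw [tailProj_apply]
    refine h4.trans ?_
    have h5 : (EuclideanSpace.proj i : Euc n →L[ℝ] ℝ) (stdFrame n j) = if i = j then 1 else 0 :=
      PiLp.single_apply 2 ℝ j 1 i
    rw [h5]
    split_ifs <;> ring
  have hdet : detForm n (fun i => tailProj n (partials (stdFrame n) (oscMap n σ ε k) u i)) =
      ∏ i, (ε * (k * Real.cos (k * u i))) := by
    rw [detForm_apply, ← Matrix.det_diagonal]
    congr 1
    ext i j
    rw [Matrix.of_apply, hpart, Matrix.diagonal_apply]
  rw [hdet, Finset.prod_mul_distrib, Finset.prod_mul_distrib, Finset.prod_pow]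
  simp
  ring

/-- The integral equals 1 + sin k cos k / k, and 2 sin k cos k ≥ -1. -/
theorem integral_cos_sq_ge {k : ℝ} (hk : 1 ≤ k) :
    (1 / 2 : ℝ) ≤ ∫ x in Set.Icc (-1 : ℝ) 1, Real.cos (k * x) ^ 2 := by
  have hk0 : 0 < k := by linarith
  rw [integral_Icc_eq_integral_Ioc, ← intervalIntegral.integral_of_le (by norm_num),
    intervalIntegral.integral_comp_mul_left (fun x => Real.cos x ^ 2) hk0.ne', integral_cos_sq,
    smul_eq_mul, mul_neg, Real.cos_neg, Real.sin_neg, mul_one, inv_mul_eq_div, le_div_iff₀ hk0]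
  nlinarith [sq_nonneg (Real.cos k + Real.sin k), Real.sin_sq_add_cos_sq k]

/-- The cube [-1, 1]^n lies where the cutoff is 1, and the integrand is nonnegative elsewhere; on
the cube the integral factors. -/
theorem integral_cutoff_cos_ge {k : ℝ} (hk : 1 ≤ k) :
    (1 / 2 : ℝ) ^ n ≤ ∫ u : Euc n, innerCutoff n u * ∏ i, Real.cos (k * u i) ^ 2 := by
  let q : ℝ → ℝ := (Set.Icc (-1 : ℝ) 1).indicator fun x => Real.cos (k * x) ^ 2
  have hq0 : ∀ x, 0 ≤ q x := fun x => Set.indicator_nonneg (fun _ _ => sq_nonneg _) x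
  have hqint : Integrable q := by
    refine (Continuous.integrableOn_Icc ?_).integrable_indicator measurableSet_Icc
    fun_prop
  have hprod : ∫ u : Euc n, ∏ i, q (u i) = (∫ x, q x) ^ n := by
    have h1 := (PiLp.volume_preserving_ofLp (Fin n)).integral_comp
      (MeasurableEquiv.toLp 2 (Fin n → ℝ)).symm.measurableEmbedding
      (fun u : Fin n → ℝ => ∏ i, q (u i))
    rw [h1, integral_fintype_prod_volume_eq_pow, Fintype.card_fin]
  have hle : ∀ u : Euc n, ∏ i, q (u i) ≤ innerCutoff n u * ∏ i, Real.cos (k * u i) ^ 2 := by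
    intro u
    by_cases hu : ∀ i, u i ∈ Set.Icc (-1 : ℝ) 1
    · have h1 : innerCutoff n u = 1 := (innerCutoff n).one_of_mem_closedBall (by
        rw [mem_closedBall_zero_iff]
        refine (euc_norm_le_sum u).trans ?_
        calc ∑ i, |u i| ≤ ∑ _i : Fin n, (1 : ℝ) :=
              Finset.sum_le_sum fun i _ => abs_le.2 (hu i)
          _ ≤ (n : ℝ) + 1 := by simp)
      rw [h1, one_mul]
      exact Finset.prod_le_prod (fun _ _ => hq0 _) fun i _ => by
        rw [show q (u i) = _ from Set.indicator_of_mem (hu i) _]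
    · push Not at hu
      obtain ⟨i, hi⟩ := hu
      rw [Finset.prod_eq_zero (Finset.mem_univ i) (Set.indicator_of_notMem hi _)]
      exact mul_nonneg (innerCutoff n).nonneg (Finset.prod_nonneg fun _ _ => sq_nonneg _)
  have hcont : Continuous fun u : Euc n => innerCutoff n u * ∏ i, Real.cos (k * u i) ^ 2 :=
    (innerCutoff n).continuous.mul (continuous_finsetProd _ fun i _ => by fun_prop)
  have hint : Integrable fun u : Euc n => innerCutoff n u * ∏ i, Real.cos (k * u i) ^ 2 :=
    hcont.integrable_of_hasCompactSupport (innerCutoff n).hasCompactSupport.mul_right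
  calc (1 / 2 : ℝ) ^ n ≤ (∫ x, q x) ^ n := by
        rw [integral_indicator measurableSet_Icc]
        gcongr
        exact integral_cos_sq_ge hk
    _ = ∫ u : Euc n, ∏ i, q (u i) := hprod.symm
    _ ≤ _ := integral_mono_of_nonneg
        (Filter.Eventually.of_forall fun u => Finset.prod_nonneg fun _ _ => hq0 _) hint
        (Filter.Eventually.of_forall hle)

end Oscillation

/-! ### Lower bound for the pullback integral, and Lipschitz bound on the sphere. -/

section Main

variable {n : ℕ}

theorem hasCompactSupport_oscMap (n : ℕ) (σ ε k : ℝ) : HasCompactSupport (oscMap n σ ε k) :=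
  HasCompactSupport.intro (isCompact_closedBall (0 : Euc n) (n + 4)) fun u hu =>
    oscMap_eq_zero (by
      rw [mem_closedBall_zero_iff, not_le] at hu
      exact hu.le)

/-- The linear part of `η` at `a` contributes `dη(a)` times the enclosed volume. -/
theorem integral_linear_oscMap (L : Euc (n + 1) →L[ℝ] Euc (n + 1) [⋀^Fin n]→L[ℝ] ℝ) (σ ε k : ℝ) :
    ∫ u, L (oscMap n σ ε k u) (partials (stdFrame n) (oscMap n σ ε k) u) =
      ContinuousAlternatingMap.alternatizeUncurryFin L (stdFrame (n + 1)) *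
        (σ * (ε ^ (n + 1) * k ^ n) *
          ∫ u : Euc n, innerCutoff n u * ∏ i, Real.cos (k * u i) ^ 2) := by
  have hφ : ContDiff ℝ 2 (oscMap n σ ε k) :=
    contDiff_infty.1 (contDiff_oscMap n σ ε k) 2
  have hs := hasCompactSupport_oscMap n σ ε k
  have h1 := integral_linear_form_partials volume (stdFrame n) L hφ hs
  -- The integral of dL depends on L only through one coefficient times the integral of det(φ, ∂φ).
  -- Applying the identity to `headForm`, whose coefficient is 1, evaluates that integral.
  have h2 := integral_linear_form_partials volume (stdFrame n) (headForm n) hφ hs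
  have htop : ∀ L : Euc (n + 1) →L[ℝ] Euc (n + 1) [⋀^Fin n]→L[ℝ] ℝ,
      ∫ u, ContinuousAlternatingMap.alternatizeUncurryFin L
        (Fin.cons (oscMap n σ ε k u) (partials (stdFrame n) (oscMap n σ ε k) u) :
          Fin (n + 1) → Euc (n + 1)) =
      ContinuousAlternatingMap.alternatizeUncurryFin L (stdFrame (n + 1)) *
        ∫ u, (EuclideanSpace.basisFun (Fin (n + 1)) ℝ).toBasis.det
          (Fin.cons (oscMap n σ ε k u) (partials (stdFrame n) (oscMap n σ ε k) u)) := fun L => by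
    rw [← integral_const_mul]
    exact integral_congr_ae (Filter.Eventually.of_forall fun u => topForm_apply _ _)
  rw [htop] at h1 h2
  simp_rw [headForm_oscMap] at h2
  rw [extDeriv_headForm, one_mul, integral_const_mul] at h2
  rw [h2] at h1
  have hn : (n + 1 : ℝ) ≠ 0 := by positivity
  refine mul_left_cancel₀ hn ?_
  rw [← h1]
  ring

/-- The pullback of `η` under a small, rapidly oscillating perturbation of a constant. -/
theorem integral_pullback_oscMap_ge (hn : n ≠ 0)
    {η : Euc (n + 1) → Euc (n + 1) [⋀^Fin n]→L[ℝ] ℝ} (hη : ContDiff ℝ 1 η) {a : Euc (n + 1)}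
    (ha : extDeriv η a (stdFrame (n + 1)) ≠ 0) :
    ∃ σ c ε₀ : ℝ, |σ| = 1 ∧ 0 < c ∧ 0 < ε₀ ∧ ∀ ε k : ℝ, 0 < ε → ε ≤ ε₀ → 1 ≤ k →
      c * (ε ^ (n + 1) * k ^ n) ≤
        ∫ u, η (a + oscMap n σ ε k u) (partials (stdFrame n) (oscMap n σ ε k) u) := by
  obtain ⟨A, hA, hlip⟩ := oscMap_lipschitz n
  set lam : ℝ := extDeriv η a (stdFrame (n + 1)) with hlam
  -- σ orients the map so that the enclosed volume has the sign of dη(a).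
  obtain ⟨σ, hσ, hσlam⟩ : ∃ σ : ℝ, |σ| = 1 ∧ lam * σ = |lam| := by
    rcases le_total 0 lam with h | h
    · exact ⟨1, by simp, by simp [abs_of_nonneg h]⟩
    · exact ⟨-1, by simp, by simp [abs_of_nonpos h]⟩
  have hlam0 : 0 < |lam| := abs_pos.2 ha
  set V : ℝ := (volume : Measure (Euc n)).real (Metric.closedBall 0 (n + 4)) with hV
  have hV0 : 0 ≤ V := measureReal_nonneg
  set Q : ℝ := (n + 1) * A ^ n * V with hQ
  have hQ0 : 0 ≤ Q := by positivity
  -- The Taylor remainder will be at most δ Q ε^(n+1) k^n; this δ makes it at most half of the lower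
  -- bound for the linear part. The + 1 guards against Q = 0.
  set δ : ℝ := |lam| * (1 / 2) ^ n / 2 / (Q + 1) with hδ
  have hδ0 : 0 < δ := by positivity
  have hδQ : δ * Q ≤ |lam| * (1 / 2) ^ n / 2 := by
    rw [hδ, div_mul_eq_mul_div, div_le_iff₀ (by positivity)]
    have : 0 ≤ |lam| * (1 / 2) ^ n / 2 := by positivity
    nlinarith
  have hdη : HasFDerivAt η (fderiv ℝ η a) a := (hη.differentiable one_ne_zero a).hasFDerivAt
  have hlittle := (hasFDerivAt_iff_isLittleO_nhds_zero.1 hdη).def hδ0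
  obtain ⟨r, hr, hball⟩ := Metric.eventually_nhds_iff.1 hlittle
  -- As |g| ≤ (n + 1) ε, this ε₀ keeps the image of g within radius r/2, where the first-order
  -- expansion holds.
  refine ⟨σ, |lam| * (1 / 2) ^ n / 2, r / (2 * (n + 1)), hσ, by positivity, by positivity,
    fun ε k hε hεr hk => ?_⟩
  have hk0 : 0 < k := by linarith
  set g := oscMap n σ ε k with hg
  have hgs : ContDiff ℝ ∞ g := contDiff_oscMap n σ ε k
  have hgs1 : ContDiff ℝ 1 g := hgs.of_le (by exact_mod_cast le_top)
  have hgs2 : ContDiff ℝ 2 g := contDiff_infty.1 hgs 2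
  have hgc : HasCompactSupport g := hasCompactSupport_oscMap n σ ε k
  have hpart : ∀ u, ‖partials (stdFrame n) g u‖ ≤ A * (ε * k) := by
    intro u
    refine (pi_norm_le_iff_of_nonneg (by positivity)).2 fun i => ?_
    have hL : LipschitzWith ⟨A * (ε * k), by positivity⟩ g :=
      LipschitzWith.of_dist_le_mul fun u v => by
        rw [dist_eq_norm, dist_eq_norm]
        exact hlip σ ε k hσ hε.le hk u v
    have h1 : ‖fderiv ℝ g u‖ ≤ A * (ε * k) := norm_fderiv_le_of_lipschitz ℝ hL
    calc ‖partials (stdFrame n) g u i‖ ≤ ‖fderiv ℝ g u‖ * ‖stdFrame n i‖ :=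
          (fderiv ℝ g u).le_opNorm _
      _ ≤ _ := by simpa [stdFrame] using h1
  have hpart0 : ∀ u, u ∉ Metric.closedBall (0 : Euc n) (n + 4) →
      partials (stdFrame n) g u = 0 := by
    intro u hu
    have : g =ᶠ[𝓝 u] fun _ => 0 := by
      filter_upwards [Metric.isClosed_closedBall.isOpen_compl.mem_nhds hu] with w hw
      rw [Set.mem_compl_iff, mem_closedBall_zero_iff, not_le] at hw
      exact oscMap_eq_zero hw.le
    ext1 i
    simp [partials, this.fderiv_eq]
  let E : Euc n → ℝ := fun u =>
    (η (a + g u) - η a - fderiv ℝ η a (g u)) (partials (stdFrame n) g u)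
  have hEb : ∀ u, ‖E u‖ ≤ δ * ((n + 1) * ε) * (A * (ε * k)) ^ n := by
    intro u
    have h1 : ‖g u‖ ≤ (n + 1) * ε := norm_oscMap_le hσ hε.le u
    have h2 : dist (g u) 0 < r := by
      rw [dist_zero_right]
      refine h1.trans_lt ?_
      rw [le_div_iff₀ (by positivity)] at hεr
      nlinarith
    refine (ContinuousAlternatingMap.le_opNorm_mul_pow_of_le _ (hpart u)).trans ?_
    gcongr
    exact (hball h2).trans (by gcongr)
  have hcη : Continuous fun u => η (a + g u) (partials (stdFrame n) g u) :=
    continuous_continuousAlternatingMap_apply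
      (hη.continuous.comp (continuous_const.add hgs.continuous)) (continuous_partials _ hgs1)
  have hca : Continuous fun u => η a (partials (stdFrame n) g u) :=
    continuous_continuousAlternatingMap_apply continuous_const (continuous_partials _ hgs1)
  have hcL : Continuous fun u => fderiv ℝ η a (g u) (partials (stdFrame n) g u) :=
    continuous_continuousAlternatingMap_apply
      ((fderiv ℝ η a).continuous.comp hgs.continuous) (continuous_partials _ hgs1)
  have hvanish : ∀ β : Euc n → Euc (n + 1) [⋀^Fin n]→L[ℝ] ℝ,
      HasCompactSupport fun u => β u (partials (stdFrame n) g u) := fun β =>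
    HasCompactSupport.intro (isCompact_closedBall (0 : Euc n) (n + 4)) fun u hu => by
      rw [hpart0 u hu]
      exact (β u).map_coord_zero ⟨0, Nat.pos_of_ne_zero hn⟩ rfl
  have hiη := hcη.integrable_of_hasCompactSupport (μ := volume) (hvanish _)
  have hia := hca.integrable_of_hasCompactSupport (μ := volume) (hvanish _)
  have hiL := hcL.integrable_of_hasCompactSupport (μ := volume) (hvanish _)
  have hEint : ∫ u, E u = (∫ u, η (a + g u) (partials (stdFrame n) g u)) -
      lam * (σ * (ε ^ (n + 1) * k ^ n) *
        ∫ u : Euc n, innerCutoff n u * ∏ i, Real.cos (k * u i) ^ 2) := by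
    simp only [E, ContinuousAlternatingMap.sub_apply]
    have h1 := integral_sub (hiη.sub hia) hiL
    simp only [Pi.sub_apply] at h1
    rw [h1, integral_sub hiη hia,
      integral_const_form_partials_eq_zero volume hn (stdFrame n) (η a) hgs2 hgc,
      integral_linear_oscMap, sub_zero]
    rfl
  have hEnorm : ‖∫ u, E u‖ ≤ δ * ((n + 1) * ε) * (A * (ε * k)) ^ n * V := by
    have hsupp : support E ⊆ Metric.closedBall (0 : Euc n) (n + 4) := by
      intro u hu
      by_contra h
      refine hu ?_
      simp only [E, hpart0 u h]
      exact ContinuousAlternatingMap.map_coord_zero _ ⟨0, Nat.pos_of_ne_zero hn⟩ rfl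
    rw [← setIntegral_eq_integral_of_forall_compl_eq_zero fun u hu => by
      by_contra h
      exact hu (hsupp h)]
    exact norm_setIntegral_le_of_norm_le_const measure_closedBall_lt_top fun u _ => hEb u
  have hI := integral_cutoff_cos_ge (n := n) hk
  set I : ℝ := ∫ u : Euc n, innerCutoff n u * ∏ i, Real.cos (k * u i) ^ 2
  set w : ℝ := ε ^ (n + 1) * k ^ n with hw
  have hw0 : 0 < w := by positivity
  have h1 : δ * ((n + 1) * ε) * (A * (ε * k)) ^ n * V = δ * Q * w := by
    rw [hQ, hw]; ring
  rw [h1] at hEnorm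
  have h2 := (abs_le.1 hEnorm).1
  have h3 : lam * (σ * w * I) = |lam| * w * I := by rw [← hσlam]; ring
  rw [hEint, h3] at h2
  have h4 : δ * Q * w ≤ |lam| * (1 / 2) ^ n / 2 * w := by gcongr
  have h5 : |lam| * w * (1 / 2) ^ n ≤ |lam| * w * I := by gcongr
  nlinarith

theorem gnomonic_lipschitz {δ : ℝ} (hδ : 0 < δ) {x y : Euc (n + 1)} (hy : ‖y‖ = 1)
    (hx0 : δ ≤ x 0) (hy0 : δ ≤ y 0) :
    ‖gnomonic n x - gnomonic n (y : Euc (n + 1))‖ ≤ (1 / δ + 1 / δ ^ 2) * ‖x - (y : Euc (n + 1))‖ := by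
  have hx0' : 0 < x 0 := hδ.trans_le hx0
  have hy0' : 0 < y 0 := hδ.trans_le hy0
  have htail : ∀ z : Euc (n + 1), ‖tailProj n z‖ ≤ ‖z‖ := fun z => by
    have := eq_sum_head_tail_norm_sq n z
    refine abs_le_of_sq_le_sq' ?_ (norm_nonneg _) |>.2
    nlinarith [sq_nonneg (z 0)]
  have hdec : gnomonic n x - gnomonic n y =
      (x 0)⁻¹ • tailProj n (x - y) + ((y 0 - x 0) * ((x 0)⁻¹ * (y 0)⁻¹)) • tailProj n y := by
    have : (y 0 - x 0) * ((x 0)⁻¹ * (y 0)⁻¹) = (x 0)⁻¹ - (y 0)⁻¹ := by field_simp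
    rw [this, map_sub, gnomonic, gnomonic, smul_sub, sub_smul]
    abel
  have h1 : (x 0)⁻¹ ≤ 1 / δ := by rw [one_div]; gcongr
  have h2 : (y 0)⁻¹ ≤ 1 / δ := by rw [one_div]; gcongr
  have h3 : |y 0 - x 0| ≤ ‖x - (y : Euc (n + 1))‖ := by
    rw [abs_sub_comm]; exact abs_apply_le_norm (x - y) 0
  rw [hdec]
  refine (norm_add_le _ _).trans ?_
  rw [norm_smul, norm_smul, norm_mul, norm_mul, norm_inv, norm_inv, Real.norm_of_nonneg hx0'.le,
    Real.norm_of_nonneg hy0'.le, Real.norm_eq_abs, add_mul]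
  refine add_le_add (mul_le_mul h1 (htail _) (norm_nonneg _) (by positivity)) ?_
  calc |y 0 - x 0| * ((x 0)⁻¹ * (y 0)⁻¹) * ‖tailProj n y‖
      ≤ ‖x - (y : Euc (n + 1))‖ * (1 / δ * (1 / δ)) * 1 := by
        gcongr
        exact (htail y).trans hy.le
    _ = _ := by ring

/-- The chart is not Lipschitz up to the equator, but where g is nonzero one has x₀ ≥ 1/(1 + R) =
2δ. If also y₀ ≥ δ, the chart is Lipschitz at both points; otherwise |x - y| ≥ δ and the sup bound
on g suffices. -/
theorem conicExt_lipschitz {g : Euc n → Euc (n + 1)} {R B b : ℝ} (hR : 0 ≤ R) (hB : 0 ≤ B)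
    (hg : ∀ u, R ≤ ‖u‖ → g u = 0) (hb : ∀ u, ‖g u‖ ≤ b)
    (hl : ∀ u v, ‖g u - g v‖ ≤ B * ‖u - v‖) (a : Euc (n + 1)) (x y : Sph n) :
    ‖conicExt a g x - conicExt a g y‖ ≤
      (B * (2 * (1 + R) + (2 * (1 + R)) ^ 2) + 2 * b * (2 * (1 + R))) * dist x y := by
  have hb0 : 0 ≤ b := (norm_nonneg _).trans (hb 0)
  have hsub : ∀ x y : Euc (n + 1), conicExt a g x - conicExt a g y =
      (if 0 < x 0 then g (gnomonic n x) else 0) - (if 0 < y 0 then g (gnomonic n y) else 0) :=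
    fun x y => by simp [conicExt]
  have hGb : ∀ x : Euc (n + 1), ‖(if 0 < x 0 then g (gnomonic n x) else 0)‖ ≤ b := fun x => by
    split_ifs
    · exact hb _
    · simpa using hb0
  wlog hx : (if 0 < (x : Euc (n + 1)) 0 then g (gnomonic n x) else 0) ≠ 0 generalizing x y
  · by_cases hy : (if 0 < (y : Euc (n + 1)) 0 then g (gnomonic n y) else 0) ≠ 0
    · rw [norm_sub_rev, dist_comm]
      exact this y x hy
    · rw [hsub, not_not.1 hx, not_not.1 hy]
      simp
      positivity
  set δ : ℝ := 1 / (2 * (1 + R)) with hδ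
  have hδ0 : 0 < δ := by positivity
  have hnx : ‖(x : Euc (n + 1))‖ = 1 := by simp
  have hny : ‖(y : Euc (n + 1))‖ = 1 := by simp
  have hd : dist x y = ‖(x : Euc (n + 1)) - (y : Euc (n + 1))‖ := by rw [Subtype.dist_eq, dist_eq_norm]
  have hx0 : 0 < (x : Euc (n + 1)) 0 := by
    by_contra h
    exact hx (if_neg h)
  have hx1 : 2 * δ ≤ (x : Euc (n + 1)) 0 := by
    rw [if_pos hx0] at hx
    have h1 : ‖gnomonic n (x : Euc (n + 1))‖ < R := by
      by_contra h
      exact hx (hg _ (not_lt.1 h))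
    rw [gnomonic, norm_smul, norm_inv, Real.norm_of_nonneg hx0.le, inv_mul_eq_div,
      div_lt_iff₀ hx0] at h1
    have h2 := eq_sum_head_tail_norm_sq n (x : Euc (n + 1))
    rw [hnx] at h2
    have h3 : (1 : ℝ) ≤ (1 + R) * (x : Euc (n + 1)) 0 := by
      have h4 := norm_nonneg (tailProj n (x : Euc (n + 1)))
      have h5 : (1 : ℝ) ≤ (x : Euc (n + 1)) 0 + ‖tailProj n (x : Euc (n + 1))‖ := by
        refine abs_le_of_sq_le_sq' ?_ (by positivity) |>.2
        nlinarith
      linarith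
    rw [hδ]
    field_simp
    linarith
  have hδi : 1 / δ = 2 * (1 + R) := by rw [hδ, one_div_one_div]
  have hδi2 : 1 / δ ^ 2 = (2 * (1 + R)) ^ 2 := by rw [← one_div_pow, hδi]
  rw [← hδi2, ← hδi, hd, hsub]
  rcases le_total δ ((y : Euc (n + 1)) 0) with hy | hy
  · rw [if_pos hx0, if_pos (hδ0.trans_le hy)]
    calc _ ≤ B * ‖gnomonic n (x : Euc (n + 1)) - gnomonic n (y : Euc (n + 1))‖ := hl _ _
      _ ≤ B * ((1 / δ + 1 / δ ^ 2) * ‖(x : Euc (n + 1)) - (y : Euc (n + 1))‖) := by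
          gcongr
          exact gnomonic_lipschitz hδ0 hny (by linarith) hy
      _ ≤ _ := by
          have : 0 ≤ 2 * b * (1 / δ) * ‖(x : Euc (n + 1)) - (y : Euc (n + 1))‖ := by positivity
          linarith
  · have h1 : δ ≤ ‖(x : Euc (n + 1)) - (y : Euc (n + 1))‖ := by
      refine le_trans ?_ (abs_apply_le_norm ((x : Euc (n + 1)) - (y : Euc (n + 1))) 0)
      refine le_trans ?_ (le_abs_self _)
      rw [PiLp.sub_apply]
      linarith
    calc _ ≤ b + b := (norm_sub_le _ _).trans (add_le_add (hGb _) (hGb _))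
      _ = 2 * b * (1 / δ) * δ := by field_simp; ring
      _ ≤ 2 * b * (1 / δ) * ‖(x : Euc (n + 1)) - (y : Euc (n + 1))‖ := by gcongr
      _ ≤ _ := by
          have : 0 ≤ B * (1 / δ + 1 / δ ^ 2) * ‖(x : Euc (n + 1)) - (y : Euc (n + 1))‖ := by positivity
          linarith

end Main

end

/-! ### Conclusion: amplitude tied to frequency. -/

/-- Every `n`-form `η` on `ℝ^{n+1}` is allowed for which `∫_{S^n} η ≠ 0`; in particular each smooth
extension of the volume form of `S^n`, whatever its normalization. -/
theorem proposition2p4 (n : ℕ) (s : ℝ) (hs0 : 0 < s) (hs : s < (n : ℝ) / ((n : ℝ) + 1))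
    (η : Euc (n + 1) → Euc (n + 1) [⋀^Fin n]→L[ℝ] ℝ) (hη : ContDiff ℝ ∞ η)
    (hvol : integralForm (pullbackForm (Subtype.val : Sph n → Euc (n + 1)) η) ≠ 0) :
    ∃ f : ℕ → Sph n → Euc (n + 1),
      (∀ k, ContMDiff (𝓡 n) 𝓘(ℝ, Euc (n + 1)) ∞ (f k)) ∧
      (⨆ k, (MeasureTheory.eLpNorm (f k) ⊤ (surfaceMeasure n) +
        gagliardoSeminorm n s ((n : ℝ) / s) (f k))) < ⊤ ∧
      Filter.Tendsto (fun k => integralForm (pullbackForm (f k) η)) Filter.atTop Filter.atTop := by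
  have hn : n ≠ 0 := by
    rintro rfl
    simp at hs
    linarith
  have hη1 : ContDiff ℝ 1 η := hη.of_le (by exact_mod_cast le_top)
  obtain ⟨a, ha⟩ := exists_extDeriv_ne_zero hη1 hvol
  obtain ⟨σ, c, ε₀, hσ, hc, hε₀, hmain⟩ := integral_pullback_oscMap_ge hn hη1 ha
  obtain ⟨A, hA, hlip⟩ := oscMap_lipschitz n
  have hsn : s * (n + 1) < n := by rwa [lt_div_iff₀ (by positivity)] at hs
  have hp : (n : ℝ) + 1 ≤ n / s := by
    rw [le_div_iff₀ hs0]
    linarith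
  obtain ⟨C, hC, hgag⟩ := gagliardoSeminorm_le hn hp (s := s) (by field_simp)
  let κ : ℕ → ℝ := fun j => (j : ℝ) + 1
  have hκ1 : ∀ j, 1 ≤ κ j := fun j => by simp [κ]
  have hκ0 : ∀ j, 0 < κ j := fun j => by linarith [hκ1 j]
  -- The largest power of κ for which the energy bound ε^(n/s) κ^n stays bounded.
  let ε : ℕ → ℝ := fun j => κ j ^ (-s)
  have hε0 : ∀ j, 0 < ε j := fun j => Real.rpow_pos_of_pos (hκ0 j) _
  have hε1 : ∀ j, ε j ≤ 1 := fun j => Real.rpow_le_one_of_one_le_of_nonpos (hκ1 j) (by linarith)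
  let g : ℕ → Euc n → Euc (n + 1) := fun j => oscMap n σ (ε j) (κ j)
  have hgs : ∀ j, ContDiff ℝ ∞ (g j) := fun j => contDiff_oscMap _ _ _ _
  have hg0 : ∀ j u, (n : ℝ) + 4 ≤ ‖u‖ → g j u = 0 := fun j u hu => oscMap_eq_zero hu
  let f : ℕ → Sph n → Euc (n + 1) := fun j x => conicExt a (g j) x
  have hκtop : Filter.Tendsto κ Filter.atTop Filter.atTop :=
    Filter.tendsto_atTop_add_const_right _ _ tendsto_natCast_atTop_atTop
  refine ⟨f, fun j => contMDiff_conicExt a (hgs j) (hg0 j), ?_, ?_⟩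
  · have hgb : ∀ j u, ‖g j u‖ ≤ (n + 1) * ε j := fun j u => norm_oscMap_le hσ (hε0 j).le u
    set ρ : ℝ := 2 * (1 + (n + 4)) with hρ
    have hρ0 : 0 < ρ := by positivity
    -- One constant for both bounds: the last term covers the oscillation, the others the Lipschitz
    -- constant from `conicExt_lipschitz` with R = n + 4.
    set D : ℝ := A * (ρ + ρ ^ 2) + 2 * (n + 1) * ρ + 2 * (n + 1) with hD
    have hD0 : 0 ≤ D := by positivity
    have hfb : ∀ j x, ‖f j x - a‖ ≤ (n + 1) * ε j := by
      intro j x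
      simp only [f, conicExt, add_sub_cancel_left]
      split_ifs
      · exact hgb _ _
      · rw [norm_zero]
        have := (hε0 j).le
        positivity
    have hosc : ∀ j x y, ‖f j x - f j y‖ ≤ D * ε j := by
      intro j x y
      have h1 : f j x - f j y = (f j x - a) - (f j y - a) := by abel
      rw [h1]
      refine (norm_sub_le _ _).trans ((add_le_add (hfb j x) (hfb j y)).trans ?_)
      have := (hε0 j).le
      have h2 : 0 ≤ (A * (ρ + ρ ^ 2) + 2 * (n + 1) * ρ) * ε j := by positivity
      rw [hD]
      linarith
    have hflip : ∀ j x y, ‖f j x - f j y‖ ≤ D * ε j * (κ j * dist x y) := by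
      intro j x y
      have hεj := (hε0 j).le
      have hκj := (hκ0 j).le
      refine (conicExt_lipschitz (by positivity) (by positivity) (hg0 j) (hgb j)
        (hlip σ (ε j) (κ j) hσ hεj (hκ1 j)) a x y).trans ?_
      rw [← mul_assoc (D * ε j)]
      refine mul_le_mul_of_nonneg_right ?_ (dist_nonneg (x := x) (y := y))
      rw [← hρ]
      have h1 : ε j ≤ ε j * κ j := le_mul_of_one_le_right hεj (hκ1 j)
      have h2 : 0 ≤ 2 * ((n : ℝ) + 1) * (ε j * κ j) := by positivity
      have h3 : 2 * ((n + 1) * ε j) * ρ ≤ 2 * ((n + 1) * (ε j * κ j)) * ρ := by gcongr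
      calc A * (ε j * κ j) * (ρ + ρ ^ 2) + 2 * ((n + 1) * ε j) * ρ
          ≤ A * (ε j * κ j) * (ρ + ρ ^ 2) + 2 * ((n + 1) * (ε j * κ j)) * ρ +
            2 * ((n : ℝ) + 1) * (ε j * κ j) := by linarith
        _ = D * ε j * κ j := by rw [hD]; ring
    have hpow : ∀ j, (D * ε j) ^ ((n : ℝ) / s) * κ j ^ n = D ^ ((n : ℝ) / s) := by
      intro j
      rw [Real.mul_rpow hD0 (hε0 j).le, ← Real.rpow_mul (hκ0 j).le, mul_assoc,
        ← Real.rpow_natCast (κ j) n, ← Real.rpow_add (hκ0 j)]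
      rw [show -s * ((n : ℝ) / s) + n = 0 by field_simp; ring, Real.rpow_zero, mul_one]
    have hbound : ∀ j, MeasureTheory.eLpNorm (f j) ⊤ (surfaceMeasure n) +
        gagliardoSeminorm n s ((n : ℝ) / s) (f j) ≤ ENNReal.ofReal (‖a‖ + (n + 1)) +
          (ENNReal.ofReal (D ^ ((n : ℝ) / s)) * C) ^ (1 / ((n : ℝ) / s)) := by
      intro j
      refine add_le_add ?_ ?_
      · rw [MeasureTheory.eLpNorm_exponent_top]
        refine MeasureTheory.eLpNormEssSup_le_of_ae_bound (Filter.Eventually.of_forall fun x => ?_)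
        have h1 : f j x = a + (f j x - a) := by abel
        rw [h1]
        refine (norm_add_le _ _).trans (add_le_add le_rfl ((hfb j x).trans ?_))
        exact mul_le_of_le_one_right (by positivity) (hε1 j)
      · have := hgag _ (f j) (D * ε j) (κ j) (mul_nonneg hD0 (hε0 j).le) (hκ0 j) (hosc j) (hflip j)
        rwa [hpow] at this
    refine (iSup_le hbound).trans_lt (ENNReal.add_lt_top.2 ⟨ENNReal.ofReal_lt_top, ?_⟩)
    exact ENNReal.rpow_lt_top_of_nonneg (by positivity)
      (ENNReal.mul_lt_top ENNReal.ofReal_lt_top hC).ne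
  · have hint : ∀ j, integralForm (pullbackForm (f j) η) =
        ∫ u, η (a + g j u) (partials (stdFrame n) (g j) u) := by
      intro j
      have hg1 : ContDiff ℝ 1 (g j) := (hgs j).of_le (by exact_mod_cast le_top)
      have hcont : Continuous fun u => η (a + g j u) (partials (stdFrame n) (g j) u) :=
        continuous_continuousAlternatingMap_apply
          (hη1.continuous.comp (continuous_const.add hg1.continuous)) (continuous_partials _ hg1)
      rw [← integral_gnomonic n hcont]
      · unfold integralForm
        simp only [f]
        simp_rw [density_conicExt hn a (hgs j) (hg0 j)]
      · refine ((hasCompactSupport_oscMap n σ (ε j) (κ j)).fderiv (𝕜 := ℝ)).mono fun u hu h0 => hu ?_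
        refine ContinuousAlternatingMap.map_coord_zero _ ⟨0, Nat.pos_of_ne_zero hn⟩ ?_
        change fderiv ℝ (oscMap n σ (ε j) (κ j)) u _ = 0
        rw [h0]
        rfl
    have hεtendsto : Filter.Tendsto ε Filter.atTop (𝓝 0) :=
      (tendsto_rpow_neg_atTop hs0).comp hκtop
    have hev : ∀ᶠ j in Filter.atTop, ε j ≤ ε₀ :=
      (hεtendsto.eventually (gt_mem_nhds hε₀)).mono fun _ h => h.le
    have hgrow : Filter.Tendsto (fun j => c * (ε j ^ (n + 1) * κ j ^ n)) Filter.atTop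
        Filter.atTop := by
      refine Filter.Tendsto.const_mul_atTop hc ?_
      -- The exponent is positive by `hsn`: this is where s < n/(n+1) makes the integrals diverge.
      have h1 : ∀ j, ε j ^ (n + 1) * κ j ^ n = κ j ^ ((n : ℝ) - s * (n + 1)) := by
        intro j
        rw [← Real.rpow_natCast (ε j), ← Real.rpow_mul (hκ0 j).le, ← Real.rpow_natCast (κ j) n,
          ← Real.rpow_add (hκ0 j)]
        congr 1
        push_cast
        ring
      simp_rw [h1]
      exact (tendsto_rpow_atTop (by linarith)).comp hκtop
    refine Filter.tendsto_atTop_mono' _ ?_ hgrow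
    filter_upwards [hev] with j hj
    rw [hint]
    exact hmain (ε j) (κ j) (hε0 j) hj (hκ1 j)
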